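/- Let $l\ge 1$ and $n,m\ge 2$ be integers and put $|N|:=l+n+m$. On $\mathbb C^k$ write $a\bullet b:=\sum_i a_ib_i$ and $|a|:=\sqrt{a\bullet\overline a}$. Let $$\mathbb H_N:=\{(x,z,w)\in\mathbb C^l\times(\mathbb C^{n+1}\setminus\{0\})\times(\mathbb C^{m+1}\setminus\{0\}) : z\bullet z=w\bullet w=0\},$$ let $\mathbb M_N$ be the intersection of $\mathbb H_N$ with the open Euclidean unit ball of $\mathbb C^{|N|+2}$, and let $dV$ be the canonical (Riemannian) volume measure of the complex manifold $\mathbb H_N\subset\mathbb C^{|N|+2}$. Write $\Theta=(\xi,\zeta,\eta)$ and $Z=(x,z,w)$. Fix complex constants $c_1,\dots,c_{|N|+2}$ and define the coefficients of the Martinelli–Bochner kernel by $$B_k(\Theta,Z):=c_k(\overline{\xi_k}-\overline{x_k})(|\zeta|^2+z\bullet\overline\zeta)(|\eta|^2+w\bullet\overline\eta)\quad(1\le k\le l),$$ $$B_{l+j}(\Theta,Z):=c_{l+j}\left((\overline{z_j}-\overline{\zeta_j})(z\bullet\overline\zeta+|\zeta|^2)-(z_j+\zeta_j)\overline{z\bullet(\zeta-z)}\right)(|\eta|^2+w\bullet\overline\eta)\quad(1\le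 j\le n+1),$$ $$B_{l+n+1+i}(\Theta,Z):=c_{l+n+1+i}\left((\overline{w_i}-\overline{\eta_i})(w\bullet\overline\eta+|\eta|^2)-(w_i+\eta_i)\overline{w\bullet(\eta-w)}\right)(|\zeta|^2+z\bullet\overline\zeta)\quad(1\le i\le m+1),$$ and set $$\Delta(\Theta,Z,Z'):=\frac1{|\zeta|^2|\eta|^2}\sum_{k=1}^{|N|+2}\left|\frac{B_k(\Theta,Z)}{|\Theta-Z|^{2|N|}}-\frac{B_k(\Theta,Z')}{|\Theta-Z'|^{2|N|}}\right|.$$ **Theorem 7.2.** Let $q$ be a real number with $1\le q<\frac{2|N|+4}{2|N|+3}$. Then there is a constant $C>0$, depending only on $l,n,m$, $q$ and the constants $c_k$, such that for all $Z,Z'\in\mathbb M_N$ $$\int_{\mathbb M_N}\Delta(\Theta,Z,Z')^q\left(\frac{|\zeta|\,|\eta|}{|\zeta_{n+1}|\,|\eta_{m+1}|}\right)^{2(q-1)}dV(\Theta)\le\begin{cases}C\,|Z-Z'|^{2|N|+4-(2|N|+3)q}&\text{if }q>1,\\ C\,|Z-Z'|\left(1+\bigl|\log|Z-Z'|\bigr|\right)&\text{if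 }q=1,\end{cases}$$ where the right-hand side is $0$ if $Z=Z'$. -/

import Mathlib

open MeasureTheory

noncomputable section

namespace MartinelliBochner

/-- The bilinear (not sesquilinear) product `a • b = ∑ᵢ aᵢ bᵢ` on `ℂᵏ`. -/
def bdot {k : ℕ} (a b : EuclideanSpace ℂ (Fin k)) : ℂ := ∑ i, a i * b i

/-- Coordinatewise complex conjugation on `ℂᵏ`. -/
def conjVec {k : ℕ} (a : EuclideanSpace ℂ (Fin k)) : EuclideanSpace ℂ (Fin k) :=
  WithLp.toLp 2 fun i => (starRingEnd ℂ) (a i)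

/-- The index set of the `l + (n+1) + (m+1) = |N| + 2` coordinates. -/
abbrev Idx (l n m : ℕ) : Type := Fin l ⊕ (Fin (n + 1) ⊕ Fin (m + 1))

/-- The ambient space `ℂˡ × ℂⁿ⁺¹ × ℂᵐ⁺¹` with its Euclidean norm. -/
abbrev Amb (l n m : ℕ) : Type := EuclideanSpace ℂ (Idx l n m)

variable {l n m : ℕ}

/-- The component in `ℂˡ` (written `x`, or `ξ` for the point `Θ`). -/
def xPart (Z : Amb l n m) : EuclideanSpace ℂ (Fin l) :=
  WithLp.toLp 2 fun i => Z (Sum.inl i)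

/-- The component in `ℂⁿ⁺¹` (written `z`, or `ζ` for the point `Θ`). -/
def zPart (Z : Amb l n m) : EuclideanSpace ℂ (Fin (n + 1)) :=
  WithLp.toLp 2 fun i => Z (Sum.inr (Sum.inl i))

/-- The component in `ℂᵐ⁺¹` (written `w`, or `η` for the point `Θ`). -/
def wPart (Z : Amb l n m) : EuclideanSpace ℂ (Fin (m + 1)) :=
  WithLp.toLp 2 fun i => Z (Sum.inr (Sum.inr i))

variable (l n m) in
/-- The complex manifold `ℍ_N`: points `(x, z, w)` with `z ≠ 0`, `w ≠ 0`, `z • z = w • w = 0`. -/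
def HN : Set (Amb l n m) :=
  {Z | zPart Z ≠ 0 ∧ wPart Z ≠ 0 ∧ bdot (zPart Z) (zPart Z) = 0 ∧ bdot (wPart Z) (wPart Z) = 0}

variable (l n m) in
/-- The manifold `𝕄_N`: the part of `ℍ_N` in the open Euclidean unit ball. -/
def MN : Set (Amb l n m) := HN l n m ∩ Metric.ball 0 1

variable (l n m) in
/-- The canonical measure `dV` of the complex manifold `ℍ_N` (complex dimension `l + n + m`), i.e.
the Riemannian volume of the metric induced by the Euclidean metric of the ambient space. For an
embedded submanifold of real dimension `d` it is the `d`-dimensional Hausdorff measure, normalized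
to agree with Lebesgue measure on `ℝᵈ`. It is seen here as a measure on the ambient space. -/
def dV : Measure (Amb l n m) := (μHE[2 * (l + n + m)]).restrict (HN l n m)

/-- The factor `|ζ|² + z • ζ̄`, for `z, ζ ∈ ℂᵏ`. -/
def fac {k : ℕ} (ζ z : EuclideanSpace ℂ (Fin k)) : ℂ :=
  (‖ζ‖ : ℂ) ^ 2 + bdot z (conjVec ζ)

/-- The `j`-th component `(z̄ⱼ - ζ̄ⱼ)(z • ζ̄ + |ζ|²) - (zⱼ + ζⱼ) conj(z • (ζ - z))`. -/
def comp {k : ℕ} (ζ z : EuclideanSpace ℂ (Fin k)) (j : Fin k) : ℂ :=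
  ((starRingEnd ℂ) (z j) - (starRingEnd ℂ) (ζ j)) * (bdot z (conjVec ζ) + (‖ζ‖ : ℂ) ^ 2)
    - (z j + ζ j) * (starRingEnd ℂ) (bdot z (ζ - z))

/-- The polynomials `B_k(Θ, Z)` of the Martinelli–Bochner formula, with numerical factors `c k`. -/
def B (c : Idx l n m → ℂ) (Θ Z : Amb l n m) : Idx l n m → ℂ
  | Sum.inl k =>
      c (Sum.inl k) * ((starRingEnd ℂ) (xPart Θ k) - (starRingEnd ℂ) (xPart Z k))
        * fac (zPart Θ) (zPart Z) * fac (wPart Θ) (wPart Z)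
  | Sum.inr (Sum.inl j) =>
      c (Sum.inr (Sum.inl j)) * comp (zPart Θ) (zPart Z) j * fac (wPart Θ) (wPart Z)
  | Sum.inr (Sum.inr i) =>
      c (Sum.inr (Sum.inr i)) * comp (wPart Θ) (wPart Z) i * fac (zPart Θ) (zPart Z)

/-- `Δ(Θ, Z, Z')`: the difference of the Martinelli–Bochner kernels at `Z` and `Z'`. -/
def Δ (c : Idx l n m → ℂ) (Θ Z Z' : Amb l n m) : ℝ :=
  1 / (‖zPart Θ‖ ^ 2 * ‖wPart Θ‖ ^ 2) *
    ∑ j : Idx l n m,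
      ‖B c Θ Z j / ((‖Θ - Z‖ ^ (2 * (l + n + m)) : ℝ) : ℂ)
        - B c Θ Z' j / ((‖Θ - Z'‖ ^ (2 * (l + n + m)) : ℝ) : ℂ)‖

/-- `|ζ| |η| / (|ζₙ₊₁| |ηₘ₊₁|)`; the set where a denominator vanishes is `dV`-null. -/
def wt (Θ : Amb l n m) : ℝ :=
  (‖zPart Θ‖ * ‖wPart Θ‖) / (‖zPart Θ (Fin.last n)‖ * ‖wPart Θ (Fin.last m)‖)

end MartinelliBochner

end

open MeasureTheory

noncomputable section

namespace MartinelliBochner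

/-! Write N = l + n + m and δ = |Z - Z'|. Apart from the cone singularities ζ = 0 and η = 0, the
kernel has order 1 - 2N on a space of real dimension 2N. Isotropy controls those singularities: the
identity z • ζ = (z - ζ) • ζ yields at once the vanishing on the diagonal and a factor |ζ|, so that
B_k is O(ρ |ζ|(|ζ|+ρ) |η|(|η|+ρ)) within distance ρ of Z. After division by |ζ|²|η|², the kernel on
the shell |Θ - Z| ~ ρ is O(ρ^(1-2N)) times (1+ρ/|ζ|)(1+ρ/|η|) (`kernelSize_le`). When |Θ - Z| ≥ 2δ,
the difference of kernels is O(δ ρ^(-2N)) times the same factor (`Δ_le`).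

The geometric input is `exists_setLIntegral_radialWeight_le`: the q-th power of that factor, times
the weight of the theorem, has integral O(r^(2N-4(q-1))) over a ball of radius r. The isotropic
cones are cut into finitely many pieces on which forgetting the dominant coordinate has a Lipschitz
inverse, so the volume is dominated by Lebesgue measure in the N remaining complex coordinates.
There the integrand is at most a constant times r^(-4(q-1)) times a product of one-variable weights
(1+r/|y|)^q, each with integral O(r²) over a disc of radius r since q < 2. The assumption n, m ≥ 2
leaves two coordinates of each cone, one to absorb 1+r/|ζ| and one to absorb |ζ|/|ζ_{n+1}|.

The rest is dyadic summation around Z. For |Θ - Z| < 2δ the two kernels are integrated separately;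
the shell exponent (1-2N)q + 2N - 4(q-1) = 2N+4-(2N+3)q is positive, which is the hypothesis on q.
For |Θ - Z| ≥ 2δ a shell contributes O(δ^q ρ^((2N+4)(1-q))). This decays geometrically if q > 1; if
q = 1 all O(1+|log δ|) shells weigh the same, whence the logarithm. -/

/-! ### Tonelli for products of one-variable functions. -/

theorem lintegral_fin_prod_eq_prod {k : ℕ} {E : Type*} [MeasurableSpace E] (μ : Measure E)
    [SigmaFinite μ] (f : Fin k → E → ENNReal) (hf : ∀ i, Measurable (f i)) :
    ∫⁻ x : Fin k → E, ∏ i, f i (x i) ∂(Measure.pi fun _ => μ) = ∏ i, ∫⁻ x, f i x ∂μ := by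
  induction k with
  | zero => simp
  | succ k ih =>
    rw [← ((measurePreserving_piFinSuccAbove (fun _ => μ) 0).symm).lintegral_comp
      (by fun_prop)]
    simp_rw [MeasurableEquiv.piFinSuccAbove_symm_apply, Fin.insertNthEquiv,
      Fin.prod_univ_succ, Fin.insertNth_zero, Equiv.coe_fn_mk, Fin.cons_succ, Fin.cons_zero]
    rw [← ih _ (fun i => hf i.succ)]
    have hg : Measurable fun x : Fin k → E => ∏ i, f i.succ (x i) :=
      Finset.measurable_prod _ fun i _ => (hf i.succ).comp (measurable_pi_apply i)
    exact lintegral_prod_mul (hf 0).aemeasurable hg.aemeasurable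

theorem lintegral_pi_prod_eq_prod {ι : Type*} [Fintype ι] {E : Type*} [MeasurableSpace E]
    (μ : Measure E) [SigmaFinite μ] (f : ι → E → ENNReal) (hf : ∀ i, Measurable (f i)) :
    ∫⁻ x : ι → E, ∏ i, f i (x i) ∂(Measure.pi fun _ => μ) = ∏ i, ∫⁻ x, f i x ∂μ := by
  let e := (Fintype.equivFin ι).symm
  rw [← (measurePreserving_piCongrLeft (fun _ : ι => μ) e).lintegral_comp (by fun_prop)]
  simp_rw [← e.prod_comp, MeasurableEquiv.coe_piCongrLeft, Equiv.piCongrLeft_apply_apply]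
  exact lintegral_fin_prod_eq_prod μ _ fun i => hf _

/-! ### Dyadic summation. -/

section Dyadic

variable {X : Type*} [MeasurableSpace X]

/-- Summation over dyadic shells shrinking to `{D = 0}`. -/
theorem setLIntegral_lt_le_of_shell (μ : Measure X) (D : X → ℝ) (Φ : X → ENNReal) {r e : ℝ}
    (hr : 0 < r) (he : 0 < e) (K : ENNReal)
    (H : ∀ ρ, 0 < ρ → ρ ≤ r →
      ∫⁻ x in {x | ρ / 2 ≤ D x ∧ D x < ρ}, Φ x ∂μ ≤ K * ENNReal.ofReal (ρ ^ e)) :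
    ∫⁻ x in {x | 0 < D x ∧ D x < r}, Φ x ∂μ
      ≤ K * ENNReal.ofReal (r ^ e * (1 - (1 / 2) ^ e)⁻¹) := by
  have hx0 : (0 : ℝ) ≤ (1 / 2) ^ e := by positivity
  have hx1 : ((1 / 2) ^ e : ℝ) < 1 := Real.rpow_lt_one (by norm_num) (by norm_num) he
  have hsub : {x | 0 < D x ∧ D x < r}
      ⊆ ⋃ j : ℕ, {x | r * (1 / 2) ^ j / 2 ≤ D x ∧ D x < r * (1 / 2) ^ j} := by
    intro x ⟨h0, h1⟩
    obtain ⟨j, hj1, hj2⟩ := exists_nat_pow_near_of_lt_one (x := D x / r) (y := (1 / 2 : ℝ))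
      (by positivity) ((div_le_one hr).2 h1.le) (by norm_num) (by norm_num)
    rw [lt_div_iff₀ hr] at hj1
    rw [div_le_iff₀ hr] at hj2
    simp only [Set.mem_iUnion, Set.mem_ofPred_eq]
    -- The power lemma gives shells closed on the outside, while the shells here are closed on the
    -- inside; a point on an outer boundary therefore moves to the preceding shell.
    rcases hj2.lt_or_eq with h | h
    · exact ⟨j, by rw [pow_succ] at hj1; linarith, by linarith⟩
    · rcases j with - | j
      · simp at h; linarith
      · refine ⟨j, ?_, ?_⟩
        · rw [h, pow_succ]; linarith
        · rw [h, pow_succ]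
          have : 0 < (1 / 2 : ℝ) ^ j * r := by positivity
          linarith
  calc _ ≤ ∫⁻ x in ⋃ j : ℕ, {x | r * (1 / 2) ^ j / 2 ≤ D x ∧ D x < r * (1 / 2) ^ j}, Φ x ∂μ :=
        lintegral_mono_set hsub
    _ ≤ ∑' j : ℕ, ∫⁻ x in {x | r * (1 / 2) ^ j / 2 ≤ D x ∧ D x < r * (1 / 2) ^ j}, Φ x ∂μ :=
        lintegral_iUnion_le _ _
    _ ≤ ∑' j : ℕ, K * ENNReal.ofReal (r ^ e * ((1 / 2) ^ e) ^ j) := by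
        refine ENNReal.tsum_le_tsum fun j => (H _ (by positivity) ?_).trans_eq ?_
        · exact mul_le_of_le_one_right hr.le (pow_le_one₀ (by norm_num) (by norm_num))
        · rw [Real.mul_rpow hr.le (by positivity), ← Real.rpow_natCast, ← Real.rpow_natCast,
            ← Real.rpow_mul (by norm_num), ← Real.rpow_mul (by norm_num), mul_comm e]
    _ = _ := by
        rw [ENNReal.tsum_mul_left, ← ENNReal.ofReal_tsum_of_nonneg (fun j => by positivity)
          ((summable_geometric_of_lt_one hx0 hx1).mul_left _), tsum_mul_left,
          tsum_geometric_of_lt_one hx0 hx1]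

/-- Summation over growing dyadic shells, with geometric decay. -/
theorem setLIntegral_ge_le_of_shell (μ : Measure X) (D : X → ℝ) (Φ : X → ENNReal) {r e : ℝ}
    (hr : 0 < r) (he : e < 0) (K : ENNReal)
    (H : ∀ ρ, r < ρ →
      ∫⁻ x in {x | ρ / 2 ≤ D x ∧ D x < ρ}, Φ x ∂μ ≤ K * ENNReal.ofReal (ρ ^ e)) :
    ∫⁻ x in {x | r ≤ D x}, Φ x ∂μ ≤ K * ENNReal.ofReal (r ^ e * (1 - 2 ^ e)⁻¹) := by
  have hx0 : (0 : ℝ) ≤ 2 ^ e := by positivity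
  have hx1 : (2 ^ e : ℝ) < 1 := Real.rpow_lt_one_of_one_lt_of_neg (by norm_num) he
  have hsub : {x | r ≤ D x}
      ⊆ ⋃ j : ℕ, {x | r * 2 ^ (j + 1) / 2 ≤ D x ∧ D x < r * 2 ^ (j + 1)} := by
    intro x h0
    obtain ⟨j, hj1, hj2⟩ := exists_nat_pow_near (x := D x / r) (y := (2 : ℝ))
      ((one_le_div hr).2 h0) (by norm_num)
    rw [le_div_iff₀ hr] at hj1
    rw [div_lt_iff₀ hr] at hj2
    simp only [Set.mem_iUnion, Set.mem_ofPred_eq]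
    exact ⟨j, by rw [pow_succ]; linarith, by linarith⟩
  calc _ ≤ ∫⁻ x in ⋃ j : ℕ, {x | r * 2 ^ (j + 1) / 2 ≤ D x ∧ D x < r * 2 ^ (j + 1)}, Φ x ∂μ :=
        lintegral_mono_set hsub
    _ ≤ ∑' j : ℕ, ∫⁻ x in {x | r * 2 ^ (j + 1) / 2 ≤ D x ∧ D x < r * 2 ^ (j + 1)}, Φ x ∂μ :=
        lintegral_iUnion_le _ _
    _ ≤ ∑' j : ℕ, K * ENNReal.ofReal (r ^ e * (2 ^ e) ^ j) := by
        refine ENNReal.tsum_le_tsum fun j => (H _ ?_).trans ?_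
        · exact lt_mul_of_one_lt_right hr (one_lt_pow₀ (by norm_num) (by omega))
        · gcongr
          rw [Real.mul_rpow hr.le (by positivity), ← Real.rpow_natCast, ← Real.rpow_natCast,
            ← Real.rpow_mul (by norm_num), ← Real.rpow_mul (by norm_num), mul_comm e]
          refine mul_le_mul_of_nonneg_left ?_ (by positivity)
          -- The j-th shell has outer radius r·2^(j+1); the extra factor 2^e is at most 1 because e
          -- < 0.
          refine Real.rpow_le_rpow_of_exponent_le (by norm_num) ?_
          push_cast
          linarith
    _ = _ := by
        rw [ENNReal.tsum_mul_left, ← ENNReal.ofReal_tsum_of_nonneg (fun j => by positivity)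
          ((summable_geometric_of_lt_one hx0 hx1).mul_left _), tsum_mul_left,
          tsum_geometric_of_lt_one hx0 hx1]

/-- Summation over finitely many dyadic shells of equal weight. -/
theorem setLIntegral_ge_lt_le_of_shell (μ : Measure X) (D : X → ℝ) (Φ : X → ENNReal) {r T : ℝ}
    (hr : 0 < r) (K : ENNReal) (M : ℕ) (hM : T ≤ r * 2 ^ M)
    (H : ∀ ρ, r < ρ → ∫⁻ x in {x | ρ / 2 ≤ D x ∧ D x < ρ}, Φ x ∂μ ≤ K) :
    ∫⁻ x in {x | r ≤ D x ∧ D x < T}, Φ x ∂μ ≤ M * K := by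
  have hsub : {x | r ≤ D x ∧ D x < T}
      ⊆ ⋃ j : Fin M, {x | r * 2 ^ (j.1 + 1) / 2 ≤ D x ∧ D x < r * 2 ^ (j.1 + 1)} := by
    intro x ⟨h0, hT⟩
    obtain ⟨j, hj1, hj2⟩ := exists_nat_pow_near (x := D x / r) (y := (2 : ℝ))
      ((one_le_div hr).2 h0) (by norm_num)
    rw [le_div_iff₀ hr] at hj1
    rw [div_lt_iff₀ hr] at hj2
    have hjM : j < M := by
      rw [← pow_lt_pow_iff_right₀ (one_lt_two (α := ℝ))]
      nlinarith
    simp only [Set.mem_iUnion, Set.mem_ofPred_eq]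
    exact ⟨⟨j, hjM⟩, by rw [pow_succ]; linarith, by dsimp only; linarith⟩
  calc _ ≤ ∫⁻ x in ⋃ j : Fin M,
          {x | r * 2 ^ (j.1 + 1) / 2 ≤ D x ∧ D x < r * 2 ^ (j.1 + 1)}, Φ x ∂μ :=
        lintegral_mono_set hsub
    _ ≤ ∑' j : Fin M,
          ∫⁻ x in {x | r * 2 ^ (j.1 + 1) / 2 ≤ D x ∧ D x < r * 2 ^ (j.1 + 1)}, Φ x ∂μ :=
        lintegral_iUnion_le _ _
    _ ≤ ∑' _ : Fin M, K := by
        refine ENNReal.tsum_le_tsum fun j => H _ ?_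
        exact lt_mul_of_one_lt_right hr (one_lt_pow₀ (by norm_num) (by omega))
    _ = _ := by simp

end Dyadic

/-! ### The one-variable singular weight. -/

/-- The weight `1 + r / |y|`, infinite at the origin. -/
def hWeight (r : ℝ) (y : ℂ) : ENNReal := 1 + ENNReal.ofReal r * (‖y‖ₑ)⁻¹

theorem one_le_hWeight (r : ℝ) (y : ℂ) : 1 ≤ hWeight r y := le_self_add

theorem measurable_hWeight (r : ℝ) : Measurable (hWeight r) := by
  unfold hWeight; fun_prop

theorem hWeight_eq_ofReal {r : ℝ} (hr : 0 ≤ r) {y : ℂ} (hy : y ≠ 0) :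
    hWeight r y = ENNReal.ofReal (1 + r / ‖y‖) := by
  have hy' : 0 < ‖y‖ := norm_pos_iff.2 hy
  rw [hWeight, ENNReal.ofReal_add one_pos.le (by positivity), ENNReal.ofReal_one, div_eq_mul_inv,
    ENNReal.ofReal_mul hr, ENNReal.ofReal_inv_of_pos hy', ofReal_norm]

/-- The function |y|^(-q) is locally integrable in the plane for q < 2, and scaling fixes the power
r². Uniformity in the centre comes from splitting at |y| = r: the inner part lies in the disc of
radius r about the origin, and on the outer part the weight is at most 2. -/
theorem exists_setLIntegral_hWeight_le {q : ℝ} (hq0 : 0 ≤ q) (hq2 : q < 2) :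
    ∃ K : NNReal, ∀ (z : ℂ) (r : ℝ), 0 < r →
      ∫⁻ y in Metric.ball z r, hWeight r y ^ q ≤ K * ENNReal.ofReal (r ^ 2) := by
  have hvol : ∀ (z : ℂ) (ρ : ℝ), 0 ≤ ρ →
      volume (Metric.ball z ρ) ≤ ENNReal.ofReal (Real.pi * ρ ^ 2) := by
    intro z ρ hρ
    rw [Complex.volume_ball, ENNReal.ofReal_mul Real.pi_pos.le, ENNReal.ofReal_pow hρ, mul_comm]
    gcongr
    rw [← NNReal.coe_real_pi, ENNReal.ofReal_coe_nnreal]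
  set A : ℝ := 4 ^ q * Real.pi with hA
  have hA0 : 0 ≤ A := by positivity
  set B : ℝ := (1 - (1 / 2) ^ (2 - q))⁻¹ with hB
  have hB0 : 0 ≤ B := by
    have : ((1 / 2) ^ (2 - q) : ℝ) < 1 :=
      Real.rpow_lt_one (by norm_num) (by norm_num) (by linarith)
    exact inv_nonneg.2 (by linarith)
  refine ⟨Real.toNNReal (A * B + A), fun z r hr => ?_⟩
  have hcover : Metric.ball z r ⊆ ({y : ℂ | 0 < ‖y‖ ∧ ‖y‖ < r} ∪ {0}) ∪
      (Metric.ball z r ∩ {y | r ≤ ‖y‖}) := by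
    intro y hy
    by_cases h : r ≤ ‖y‖
    · exact Or.inr ⟨hy, h⟩
    · by_cases h0 : y = 0
      · exact Or.inl (Or.inr h0)
      · exact Or.inl (Or.inl ⟨norm_pos_iff.2 h0, not_le.1 h⟩)
  have hnear : ∫⁻ y in {y : ℂ | 0 < ‖y‖ ∧ ‖y‖ < r}, hWeight r y ^ q
      ≤ ENNReal.ofReal (A * B * r ^ 2) := by
    have := setLIntegral_lt_le_of_shell volume (fun y : ℂ => ‖y‖) (fun y => hWeight r y ^ q)
      (r := r) (e := 2 - q) hr (by linarith) (ENNReal.ofReal (A * r ^ q)) ?_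
    · refine this.trans_eq ?_
      rw [← ENNReal.ofReal_mul (by positivity)]
      congr 1
      have : r ^ (2 : ℕ) = r ^ q * r ^ (2 - q) := by
        rw [← Real.rpow_add hr, ← Real.rpow_natCast]; congr 1; push_cast; ring
      rw [this]; ring
    · intro ρ hρ hρr
      calc ∫⁻ y in {y : ℂ | ρ / 2 ≤ ‖y‖ ∧ ‖y‖ < ρ}, hWeight r y ^ q
          ≤ ∫⁻ y in {y : ℂ | ρ / 2 ≤ ‖y‖ ∧ ‖y‖ < ρ}, ENNReal.ofReal ((4 * r / ρ) ^ q) := by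
            refine setLIntegral_mono' ?_ ?_
            · exact (measurableSet_le measurable_const measurable_norm).inter
                (measurableSet_lt measurable_norm measurable_const)
            · intro y hy
              have hy0 : 0 < ‖y‖ := by linarith [hy.1]
              rw [hWeight_eq_ofReal hr.le (norm_pos_iff.1 hy0),
                ENNReal.ofReal_rpow_of_nonneg (by positivity) hq0]
              gcongr
              have h1 : r / ‖y‖ ≤ 2 * r / ρ := by
                rw [div_le_div_iff₀ hy0 hρ]; nlinarith [hy.1]
              have h2 : 1 ≤ 2 * r / ρ := by rw [le_div_iff₀ hρ]; linarith
              calc 1 + r / ‖y‖ ≤ 2 * r / ρ + 2 * r / ρ := by linarith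
                _ = _ := by ring
        _ ≤ ENNReal.ofReal ((4 * r / ρ) ^ q) * volume (Metric.ball (0 : ℂ) ρ) := by
            rw [setLIntegral_const]
            gcongr
            intro y hy
            simpa using hy.2
        _ ≤ ENNReal.ofReal ((4 * r / ρ) ^ q) * ENNReal.ofReal (Real.pi * ρ ^ 2) := by
            gcongr; exact hvol _ _ hρ.le
        _ = _ := by
            rw [← ENNReal.ofReal_mul (by positivity), ← ENNReal.ofReal_mul (by positivity)]
            congr 1
            rw [Real.rpow_sub hρ, Real.div_rpow (by positivity) hρ.le,
              Real.mul_rpow (by norm_num) hr.le, hA]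
            norm_cast
            ring
  have hfar : ∫⁻ y in Metric.ball z r ∩ {y | r ≤ ‖y‖}, hWeight r y ^ q
      ≤ ENNReal.ofReal (A * r ^ 2) := by
    calc ∫⁻ y in Metric.ball z r ∩ {y | r ≤ ‖y‖}, hWeight r y ^ q
        ≤ ∫⁻ y in Metric.ball z r ∩ {y | r ≤ ‖y‖}, ENNReal.ofReal (4 ^ q) := by
          refine setLIntegral_mono' ?_ ?_
          · exact measurableSet_ball.inter (measurableSet_le measurable_const measurable_norm)
          · intro y hy
            have hy0 : 0 < ‖y‖ := lt_of_lt_of_le hr hy.2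
            rw [hWeight_eq_ofReal hr.le (norm_pos_iff.1 hy0),
                ENNReal.ofReal_rpow_of_nonneg (by positivity) hq0]
            gcongr
            have h1 : r / ‖y‖ ≤ 1 := (div_le_one hy0).2 hy.2
            linarith
      _ ≤ ENNReal.ofReal (4 ^ q) * ENNReal.ofReal (Real.pi * r ^ 2) := by
          rw [setLIntegral_const]
          gcongr
          exact (measure_mono Set.inter_subset_left).trans (hvol _ _ hr.le)
      _ = _ := by rw [← ENNReal.ofReal_mul (by positivity), hA, mul_assoc]
  calc ∫⁻ y in Metric.ball z r, hWeight r y ^ q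
      ≤ (ENNReal.ofReal (A * B * r ^ 2) + 0) + ENNReal.ofReal (A * r ^ 2) := by
        refine (lintegral_mono_set hcover).trans ((lintegral_union_le _ _ _).trans ?_)
        refine add_le_add ((lintegral_union_le _ _ _).trans (add_le_add hnear ?_)) hfar
        simp
    _ = _ := by
        rw [add_zero, ← ENNReal.ofReal_add (by positivity) (by positivity), ← add_mul,
          ENNReal.ofReal_mul (by positivity)]
        rfl

/-! ### Comparison of Hausdorff and Lebesgue measure. -/

/-- An injective-on-`A` map with Lipschitz inverse pushes `μHE[d]` on `A` to a measure dominated by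
Lebesgue measure on a `d`-dimensional space. -/
theorem exists_setLIntegral_comp_le {Y E : Type*} [MetricSpace Y] [MeasurableSpace Y]
    [BorelSpace Y] [NormedAddCommGroup E] [NormedSpace ℝ E] [FiniteDimensional ℝ E]
    [MeasureSpace E] [BorelSpace E] [(volume : Measure E).IsAddHaarMeasure]
    {d : ℕ} (hd : Module.finrank ℝ E = d) (L : NNReal) :
    ∃ K : NNReal, ∀ (A : Set Y) (P : Y → E), Continuous P →
      (∀ x ∈ A, ∀ y ∈ A, dist x y ≤ L * dist (P x) (P y)) → ∀ f : E → ENNReal, Measurable f →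
      ∫⁻ y in A, f (P y) ∂(μHE[d] : Measure Y) ≤ K * ∫⁻ x, f x := by
  subst hd
  set s := Measure.addHaarScalarFactor
    (volume : Measure (EuclideanSpace ℝ (Fin (Module.finrank ℝ E))))
      μH[(Module.finrank ℝ E : ℕ)] with hs
  set s' := Measure.addHaarScalarFactor (μH[(Module.finrank ℝ E : ℕ)] : Measure E) volume with hs'
  -- The norm of `E` need not be Euclidean (the charts use the sup norm), so Hausdorff measure is
  -- only known to be some multiple of Lebesgue measure, by translation invariance.
  have hE : (μH[(Module.finrank ℝ E : ℕ)] : Measure E) = s' • volume :=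
    Measure.isAddLeftInvariant_eq_smul _ _
  refine ⟨s * (L ^ (Module.finrank ℝ E) * s'), fun A P hP hL f hf => ?_⟩
  have hmap : ((μHE[Module.finrank ℝ E] : Measure Y).restrict A).map P
      ≤ (s * (L ^ (Module.finrank ℝ E) * s')) • (volume : Measure E) := by
    refine Measure.le_iff.2 fun T hT => ?_
    rw [Measure.map_apply hP.measurable hT, Measure.restrict_apply (hP.measurable hT),
      Measure.euclideanHausdorffMeasure_def]
    have hanti : AntilipschitzWith L (fun y : A => P y) :=
      AntilipschitzWith.of_le_mul_dist fun x y => hL x x.2 y y.2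
    have h1 := hanti.le_hausdorffMeasure_image (d := (Module.finrank ℝ E : ℕ)) (by positivity)
      (Subtype.val ⁻¹' (P ⁻¹' T))
    rw [← isometry_subtype_coe.hausdorffMeasure_image (Or.inl (by positivity)),
      Subtype.image_preimage_coe, Set.inter_comm] at h1
    have h2 : (fun y : A => P y) '' (Subtype.val ⁻¹' (P ⁻¹' T)) ⊆ T := by
      rintro _ ⟨y, hy, rfl⟩; exact hy
    simp only [Measure.smul_apply]
    have h3 := h1.trans (mul_le_mul_right (measure_mono h2) _)
    rw [hE, Measure.smul_apply] at h3
    simp only [ENNReal.smul_def, smul_eq_mul] at h3 ⊢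
    rw [ENNReal.rpow_natCast] at h3
    push_cast
    calc _ ≤ (s : ENNReal) * _ := mul_le_mul_right h3 _
      _ = _ := by ring
  calc ∫⁻ y in A, f (P y) ∂(μHE[Module.finrank ℝ E] : Measure Y)
      = ∫⁻ x, f x ∂(((μHE[Module.finrank ℝ E] : Measure Y).restrict A).map P) :=
        (lintegral_map hf hP.measurable).symm
    _ ≤ ∫⁻ x, f x ∂((s * (L ^ (Module.finrank ℝ E) * s')) • (volume : Measure E)) :=
        lintegral_mono' hmap le_rfl
    _ = _ := by rw [lintegral_smul_measure]; rfl

/-! ### Pieces of the isotropic cone. -/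

/-- A sign `±1` selected by a Boolean. -/
def boolSign (b : Bool) : ℝ := if b then 1 else -1

theorem exists_boolSign_mul_nonneg (x : ℝ) : ∃ b, 0 ≤ boolSign b * x := by
  rcases le_total 0 x with h | h
  · exact ⟨true, by simpa [boolSign] using h⟩
  · exact ⟨false, by simpa [boolSign] using h⟩

theorem mul_nonneg_of_boolSign {b : Bool} {x y : ℝ} (hx : 0 ≤ boolSign b * x)
    (hy : 0 ≤ boolSign b * y) : 0 ≤ x * y := by
  cases b <;> simp only [boolSign] at hx hy <;> norm_num at hx hy <;> nlinarith

/-- A closed quadrant of the complex plane. -/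
def quadrant (b : Bool × Bool) : Set ℂ :=
  {y | 0 ≤ boolSign b.1 * y.re ∧ 0 ≤ boolSign b.2 * y.im}

/-- Within one quadrant the real inner product is nonnegative, so |x+y|² ≥ |x|² + |y|². This
excludes cancellation between the two square-root branches of the dominant coordinate. -/
theorem norm_add_norm_le_of_mem_quadrant {b : Bool × Bool} {x y : ℂ} (hx : x ∈ quadrant b)
    (hy : y ∈ quadrant b) : ‖x‖ + ‖y‖ ≤ 2 * ‖x + y‖ := by
  have h1 := mul_nonneg_of_boolSign hx.1 hy.1
  have h2 := mul_nonneg_of_boolSign hx.2 hy.2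
  have hxx : ‖x‖ ^ 2 = x.re ^ 2 + x.im ^ 2 := by
    rw [Complex.sq_norm, Complex.normSq_apply]; ring
  have hyy : ‖y‖ ^ 2 = y.re ^ 2 + y.im ^ 2 := by
    rw [Complex.sq_norm, Complex.normSq_apply]; ring
  have hxy : ‖x + y‖ ^ 2 = (x.re + y.re) ^ 2 + (x.im + y.im) ^ 2 := by
    rw [Complex.sq_norm, Complex.normSq_apply, Complex.add_re, Complex.add_im]; ring
  refine abs_le_of_sq_le_sq' ?_ (by positivity) |>.2
  nlinarith [sq_nonneg (‖x‖ - ‖y‖)]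

/-- The part of the isotropic cone where the `p`-th coordinate is dominant and lies in a fixed
quadrant. -/
def conePiece {k : ℕ} (p : Fin k) (b : Bool × Bool) : Set (EuclideanSpace ℂ (Fin k)) :=
  {z | z ≠ 0 ∧ bdot z z = 0 ∧ (∀ j, ‖z j‖ ≤ ‖z p‖) ∧ z p ∈ quadrant b}

theorem exists_mem_conePiece {k : ℕ} {z : EuclideanSpace ℂ (Fin k)} (h0 : z ≠ 0)
    (hz : bdot z z = 0) : ∃ p b, z ∈ conePiece p b := by
  have hne : Nonempty (Fin k) := by
    by_contra h
    rw [not_nonempty_iff] at h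
    exact h0 (Subsingleton.elim _ _)
  obtain ⟨p, hp⟩ := Finite.exists_max fun j => ‖z j‖
  obtain ⟨b1, hb1⟩ := exists_boolSign_mul_nonneg (z p).re
  obtain ⟨b2, hb2⟩ := exists_boolSign_mul_nonneg (z p).im
  exact ⟨p, (b1, b2), h0, hz, hp, hb1, hb2⟩

theorem norm_apply_pos_of_mem_conePiece {k : ℕ} {p : Fin k} {b : Bool × Bool}
    {z : EuclideanSpace ℂ (Fin k)} (h : z ∈ conePiece p b) : 0 < ‖z p‖ := by
  by_contra h'
  refine h.1 (PiLp.ext fun j => norm_le_zero_iff.1 ?_)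
  exact (h.2.2.1 j).trans (not_lt.1 h')

/-- Subtracting the two cone equations writes (z_p - z'_p)(z_p + z'_p) as minus the sum of the same
products over the other indices. Dominance bounds each |z_i + z'_i| by |z_p| + |z'_p|, and the
quadrant condition bounds the latter by 2|z_p + z'_p|, so the sum can be divided out. -/
theorem norm_sub_apply_le_of_mem_conePiece {k : ℕ} {p : Fin k} {b : Bool × Bool}
    {z z' : EuclideanSpace ℂ (Fin k)} (hz : z ∈ conePiece p b) (hz' : z' ∈ conePiece p b)
    {d : ℝ} (hd : ∀ j, j ≠ p → ‖z j - z' j‖ ≤ d) (hd0 : 0 ≤ d) (j : Fin k) :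
    ‖z j - z' j‖ ≤ 2 * k * d := by
  have hk : (1 : ℝ) ≤ k := by exact_mod_cast (Nat.one_le_of_lt p.2)
  by_cases hj : j ≠ p
  · exact (hd j hj).trans (by nlinarith)
  rw [not_not] at hj
  subst hj
  have hid : (z j - z' j) * (z j + z' j)
      = -∑ i ∈ Finset.univ.erase j, (z i - z' i) * (z i + z' i) := by
    have h1 : ∑ i, (z i - z' i) * (z i + z' i) = 0 := by
      have : ∀ i, (z i - z' i) * (z i + z' i) = z i * z i - z' i * z' i := fun i => by ring
      simp_rw [this, Finset.sum_sub_distrib]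
      have h2 := hz.2.1
      have h3 := hz'.2.1
      rw [bdot] at h2 h3
      rw [h2, h3, sub_zero]
    rw [← Finset.add_sum_erase _ _ (Finset.mem_univ j)] at h1
    exact eq_neg_of_add_eq_zero_left h1
  have hS : 0 < ‖z j‖ + ‖z' j‖ :=
    add_pos (norm_apply_pos_of_mem_conePiece hz) (norm_apply_pos_of_mem_conePiece hz')
  have hq := norm_add_norm_le_of_mem_quadrant hz.2.2.2 hz'.2.2.2
  have hle : ‖z j - z' j‖ * ‖z j + z' j‖ ≤ k * (d * (‖z j‖ + ‖z' j‖)) := by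
    rw [← norm_mul, hid, norm_neg]
    refine (norm_sum_le _ _).trans ((Finset.sum_le_card_nsmul _ _ (d * (‖z j‖ + ‖z' j‖))
      fun i hi => ?_).trans ?_)
    · rw [norm_mul]
      exact mul_le_mul (hd i (Finset.ne_of_mem_erase hi))
        ((norm_add_le _ _).trans (add_le_add (hz.2.2.1 i) (hz'.2.2.1 i))) (norm_nonneg _) hd0
    · rw [nsmul_eq_mul]
      refine mul_le_mul_of_nonneg_right ?_ (by positivity)
      exact_mod_cast (Finset.card_le_univ _).trans_eq (Fintype.card_fin k)
  have h0 := norm_nonneg (z j - z' j)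
  refine le_of_mul_le_mul_right (a := ‖z j‖ + ‖z' j‖) ?_ hS
  nlinarith

theorem norm_le_of_mem_conePiece {k : ℕ} {p : Fin k} {b : Bool × Bool}
    {z : EuclideanSpace ℂ (Fin k)} (hz : z ∈ conePiece p b) : ‖z‖ ≤ k * ‖z p‖ := by
  have hk : (1 : ℝ) ≤ k := by exact_mod_cast (Nat.one_le_of_lt p.2)
  refine abs_le_of_sq_le_sq' ?_ (by positivity) |>.2
  rw [EuclideanSpace.norm_sq_eq]
  refine (Finset.sum_le_card_nsmul _ _ (‖z p‖ ^ 2) fun i _ => ?_).trans ?_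
  · exact pow_le_pow_left₀ (norm_nonneg _) (hz.2.2.1 i) 2
  · rw [nsmul_eq_mul, Finset.card_univ, Fintype.card_fin, mul_pow]
    gcongr
    nlinarith

theorem hWeight_rpow_le_prod {k : ℕ} {p u v : Fin k} (hu : u ≠ p) (hv : v ≠ p) (huv : u ≠ v)
    {q : ℝ} (hq : 0 < q) (r : ℝ) (z : Fin k → ℂ) :
    hWeight r (z u) ^ q * hWeight r (z v) ^ q
      ≤ ∏ j, if j ≠ p then hWeight r (z j) ^ q else 1 := by
  calc _ = ∏ j ∈ {u, v}, if j ≠ p then hWeight r (z j) ^ q else 1 := by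
        rw [Finset.prod_pair huv, if_pos hu, if_pos hv]
    _ ≤ _ := by
        refine Finset.prod_le_prod_of_subset_of_one_le' (Finset.subset_univ _) fun j _ _ => ?_
        split_ifs
        · exact ENNReal.one_le_rpow (one_le_hWeight _ _) hq
        · exact le_rfl

theorem ofReal_one_add_div_norm_le_hWeight {k : ℕ} {z : EuclideanSpace ℂ (Fin k)} {r : ℝ}
    (hr : 0 ≤ r) (v : Fin k) : ENNReal.ofReal (1 + r / ‖z‖) ≤ hWeight r (z v) := by
  by_cases h : z v = 0
  -- At z_v = 0 the right side is infinite, except for r = 0, where 0 · ∞ = 0 and both sides equal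
  -- 1.
  · rcases hr.eq_or_lt with rfl | hr
    · simp [hWeight]
    · simp [hWeight, h, ENNReal.mul_top, hr]
  · rw [hWeight_eq_ofReal hr h]
    have := norm_pos_iff.2 h
    gcongr
    exact PiLp.norm_apply_le z v

/-- On a piece of the cone, the singular weights are dominated by a product of functions of the
coordinates other than the dominant one. -/
theorem coneWeight_le_prod {k : ℕ} (hk : 2 ≤ k) {p : Fin (k + 1)} {b : Bool × Bool}
    {z : EuclideanSpace ℂ (Fin (k + 1))} (hz : z ∈ conePiece p b) (hz1 : ‖z‖ ≤ 1)
    {q r : ℝ} (hq1 : 1 ≤ q) (hq2 : q < 2) (hr : 0 < r) (hr4 : r ≤ 4) :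
    ENNReal.ofReal (1 + r / ‖z‖) ^ q
        * ENNReal.ofReal ((‖z‖ / ‖z (Fin.last k)‖) ^ (2 * (q - 1)))
      ≤ ENNReal.ofReal (16 * (k + 1) ^ 2 * r ^ (-(2 * (q - 1))))
        * ∏ j, if j ≠ p then hWeight r (z j) ^ q else 1 := by
  have ha0 : 0 ≤ 2 * (q - 1) := by linarith
  have ha2 : 2 * (q - 1) ≤ 2 := by linarith
  have hkk : (1 : ℝ) ≤ (k + 1) ^ 2 := one_le_pow₀ (by linarith [k.cast_nonneg (α := ℝ)])
  -- The constant 16 makes 16·r^(-2(q-1)) ≥ 1 for r ≤ 4, so that the prefactor also covers the case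
  -- where no power of r is lost.
  have hra : (1 : ℝ) / 16 ≤ r ^ (-(2 * (q - 1))) := by
    rw [Real.rpow_neg hr.le, one_div]
    refine inv_anti₀ (by positivity) ?_
    calc r ^ (2 * (q - 1)) ≤ 4 ^ (2 * (q - 1)) := Real.rpow_le_rpow hr.le hr4 ha0
      _ ≤ 4 ^ (2 : ℝ) := Real.rpow_le_rpow_of_exponent_le (by norm_num) ha2
      _ = 16 := by norm_num
  have hq0 : 0 < q := by linarith
  -- If the last coordinate is dominant, the ratio |z|/|z_last| is at most k + 1. Otherwise z_last
  -- is kept by the chart and its own factor absorbs the ratio.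
  by_cases hp : p = Fin.last k
  · subst hp
    obtain ⟨v, hv⟩ : ∃ v : Fin (k + 1), v ≠ Fin.last k := ⟨0, fun h => by
      have := congrArg Fin.val h; simp at this; omega⟩
    have h1 : (‖z‖ / ‖z (Fin.last k)‖) ^ (2 * (q - 1))
        ≤ 16 * (k + 1) ^ 2 * r ^ (-(2 * (q - 1))) := by
      have hpos := norm_apply_pos_of_mem_conePiece hz
      have h2 : ‖z‖ / ‖z (Fin.last k)‖ ≤ k + 1 := by
        rw [div_le_iff₀ hpos]; exact_mod_cast norm_le_of_mem_conePiece hz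
      calc (‖z‖ / ‖z (Fin.last k)‖) ^ (2 * (q - 1)) ≤ ((k : ℝ) + 1) ^ (2 * (q - 1)) :=
            Real.rpow_le_rpow (by positivity) h2 ha0
        _ ≤ ((k : ℝ) + 1) ^ (2 : ℝ) := Real.rpow_le_rpow_of_exponent_le (by simp) ha2
        _ = (k + 1) ^ 2 := by norm_cast
        _ ≤ _ := by nlinarith
    rw [mul_comm]
    refine mul_le_mul' (ENNReal.ofReal_le_ofReal h1) ?_
    obtain ⟨u, hu, huv⟩ : ∃ u : Fin (k + 1), u ≠ Fin.last k ∧ u ≠ v := by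
      by_contra! h
      have h0 := h ⟨0, by omega⟩ (by simp [Fin.ext_iff]; omega)
      have h1 := h ⟨1, by omega⟩ (by simp [Fin.ext_iff]; omega)
      rw [← h0] at h1
      simp at h1
    refine le_trans ?_ (hWeight_rpow_le_prod hu hv huv hq0 r z)
    refine (ENNReal.rpow_le_rpow (ofReal_one_add_div_norm_le_hWeight hr.le v) hq0.le).trans ?_
    exact le_mul_of_one_le_left' (ENNReal.one_le_rpow (one_le_hWeight _ _) hq0)
  -- With at least three coordinates, one is neither dominant nor last; it absorbs 1 + r/|z|.
  · obtain ⟨v, hvp, hvl⟩ : ∃ v : Fin (k + 1), v ≠ p ∧ v ≠ Fin.last k := by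
      by_contra! h
      by_cases h0 : (⟨0, by omega⟩ : Fin (k + 1)) = p
      · have h1 := h ⟨1, by omega⟩ (by rw [← h0]; simp)
        simp [Fin.ext_iff] at h1; omega
      · have h1 := h _ h0
        simp [Fin.ext_iff] at h1; omega
    have h1 : ENNReal.ofReal ((‖z‖ / ‖z (Fin.last k)‖) ^ (2 * (q - 1)))
        ≤ ENNReal.ofReal (16 * (k + 1) ^ 2 * r ^ (-(2 * (q - 1))))
          * hWeight r (z (Fin.last k)) ^ q := by
      -- Here |z| ≤ 1 costs the power r^(-2(q-1)), and 2(q-1) ≤ q allows the exponent to be raised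
      -- to q.
      have h2 : (‖z‖ / ‖z (Fin.last k)‖) ^ (2 * (q - 1))
          ≤ r ^ (-(2 * (q - 1))) * (1 + r / ‖z (Fin.last k)‖) ^ q := by
        calc (‖z‖ / ‖z (Fin.last k)‖) ^ (2 * (q - 1))
            ≤ (r⁻¹ * (r / ‖z (Fin.last k)‖)) ^ (2 * (q - 1)) := by
              refine Real.rpow_le_rpow (by positivity) ?_ ha0
              rw [← mul_div_assoc, inv_mul_cancel₀ hr.ne']
              gcongr
          _ = r ^ (-(2 * (q - 1))) * (r / ‖z (Fin.last k)‖) ^ (2 * (q - 1)) := by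
              rw [Real.mul_rpow (by positivity) (by positivity), Real.inv_rpow hr.le,
                Real.rpow_neg hr.le]
          _ ≤ r ^ (-(2 * (q - 1))) * (1 + r / ‖z (Fin.last k)‖) ^ (2 * (q - 1)) := by
              gcongr; linarith
          _ ≤ _ := by
              refine mul_le_mul_of_nonneg_left ?_ (by positivity)
              refine Real.rpow_le_rpow_of_exponent_le ?_ (by linarith)
              exact le_add_of_nonneg_right (by positivity)
      have h3 : ENNReal.ofReal (1 + r / ‖z (Fin.last k)‖) ≤ hWeight r (z (Fin.last k)) := by
        by_cases h : z (Fin.last k) = 0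
        · simp [hWeight, h]
        · rw [hWeight_eq_ofReal hr.le h]
      refine (ENNReal.ofReal_le_ofReal h2).trans ?_
      rw [ENNReal.ofReal_mul (by positivity), ← ENNReal.ofReal_rpow_of_nonneg (by positivity) hq0.le]
      refine mul_le_mul' (ENNReal.ofReal_le_ofReal ?_) (ENNReal.rpow_le_rpow h3 hq0.le)
      have : 0 ≤ r ^ (-(2 * (q - 1))) := by positivity
      nlinarith
    calc _ ≤ hWeight r (z v) ^ q * (ENNReal.ofReal (16 * (k + 1) ^ 2 * r ^ (-(2 * (q - 1))))
          * hWeight r (z (Fin.last k)) ^ q) :=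
          mul_le_mul' (ENNReal.rpow_le_rpow
            (ofReal_one_add_div_norm_le_hWeight hr.le v) hq0.le) h1
      _ = ENNReal.ofReal (16 * (k + 1) ^ 2 * r ^ (-(2 * (q - 1))))
          * (hWeight r (z v) ^ q * hWeight r (z (Fin.last k)) ^ q) := by ring
      _ ≤ _ := mul_le_mul_right (hWeight_rpow_le_prod hvp (Ne.symm hp) hvl hq0 r z) _

/-! ### Charts of ℍ_N and weighted volume growth. -/

variable {l n m : ℕ}

/-- The coordinates kept by the chart that drops one `z`- and one `w`-coordinate. -/
abbrev ChartIdx (l : ℕ) {n m : ℕ} (p : Fin (n + 1)) (p' : Fin (m + 1)) : Type :=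
  {i : Idx l n m // i ≠ Sum.inr (Sum.inl p) ∧ i ≠ Sum.inr (Sum.inr p')}

theorem card_chartIdx (p : Fin (n + 1)) (p' : Fin (m + 1)) :
    Fintype.card (ChartIdx l p p') = l + n + m := by
  have h : (Finset.univ.filter fun i : Idx l n m =>
      i ≠ Sum.inr (Sum.inl p) ∧ i ≠ Sum.inr (Sum.inr p'))
      = (Finset.univ.erase (Sum.inr (Sum.inl p))).erase (Sum.inr (Sum.inr p')) := by
    ext i; simp [and_comm]
  rw [Fintype.card_subtype, h, Finset.card_erase_of_mem (by simp),
    Finset.card_erase_of_mem (by simp)]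
  simp
  omega

/-- The coordinate projection `ℍ_N → ℂᴺ` that drops one `z`- and one `w`-coordinate. -/
def chart (p : Fin (n + 1)) (p' : Fin (m + 1)) (Z : Amb l n m) : ChartIdx l p p' → ℂ :=
  fun i => Z i

theorem continuous_chart (p : Fin (n + 1)) (p' : Fin (m + 1)) :
    Continuous (chart (l := l) p p') := by
  unfold chart; fun_prop

variable (l) in
/-- The product of two pieces of cones with the flat factor. -/
def HNPiece (p : Fin (n + 1)) (p' : Fin (m + 1)) (b b' : Bool × Bool) : Set (Amb l n m) :=
  {Z | zPart Z ∈ conePiece p b ∧ wPart Z ∈ conePiece p' b'}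

/-- The two forgotten coordinates are recovered by `norm_sub_apply_le_of_mem_conePiece`; the factor
l+n+m+2 passes from the sup norm to the Euclidean norm. -/
theorem dist_le_chart {p : Fin (n + 1)} {p' : Fin (m + 1)} {b b' : Bool × Bool}
    {Z Z' : Amb l n m} (hZ : Z ∈ HNPiece l p p' b b') (hZ' : Z' ∈ HNPiece l p p' b b') :
    dist Z Z' ≤ ((l + n + m + 2) * (2 * (n + m + 2)) : NNReal)
      * dist (chart p p' Z) (chart p p' Z') := by
  set d := dist (chart p p' Z) (chart p p' Z') with hd
  have hd0 : 0 ≤ d := dist_nonneg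
  have hi : ∀ i : ChartIdx l p p', ‖Z i - Z' i‖ ≤ d := fun i => by
    rw [← dist_eq_norm]; exact dist_le_pi_dist (chart p p' Z) (chart p p' Z') i
  have hn0 : (0 : ℝ) ≤ n := n.cast_nonneg
  have hm0 : (0 : ℝ) ≤ m := m.cast_nonneg
  have hl0 : (0 : ℝ) ≤ l := l.cast_nonneg
  have hall : ∀ i, ‖Z i - Z' i‖ ≤ 2 * (n + m + 2) * d := by
    rintro (i | i | i)
    · exact (hi ⟨Sum.inl i, by simp⟩).trans (by nlinarith)
    · refine (norm_sub_apply_le_of_mem_conePiece hZ.1 hZ'.1 (d := d)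
        (fun j hj => hi ⟨Sum.inr (Sum.inl j), by simpa using hj⟩) hd0 i).trans ?_
      push_cast; nlinarith
    · refine (norm_sub_apply_le_of_mem_conePiece hZ.2 hZ'.2 (d := d)
        (fun j hj => hi ⟨Sum.inr (Sum.inr j), by simpa using hj⟩) hd0 i).trans ?_
      push_cast; nlinarith
  rw [dist_eq_norm]
  push_cast
  refine abs_le_of_sq_le_sq' ?_ (by positivity) |>.2
  rw [EuclideanSpace.norm_sq_eq]
  refine (Finset.sum_le_card_nsmul _ _ ((2 * (n + m + 2) * d) ^ 2) fun i _ => ?_).trans ?_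
  · exact pow_le_pow_left₀ (norm_nonneg _) (hall i) 2
  · rw [nsmul_eq_mul, Finset.card_univ]
    rw [show (((l : ℝ) + n + m + 2) * (2 * (n + m + 2)) * d) ^ 2
      = (l + n + m + 2) ^ 2 * (2 * (n + m + 2) * d) ^ 2 by ring]
    refine mul_le_mul_of_nonneg_right ?_ (by positivity)
    simp only [Fintype.card_sum, Fintype.card_fin]
    push_cast
    nlinarith

/-- The weight `(1 + r/|ζ|)^q (1 + r/|η|)^q (|ζ||η| / (|ζₙ₊₁||ηₘ₊₁|))^{2(q-1)}`. -/
def radialWeight (q r : ℝ) (Θ : Amb l n m) : ENNReal :=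
  ENNReal.ofReal (1 + r / ‖zPart Θ‖) ^ q * ENNReal.ofReal (1 + r / ‖wPart Θ‖) ^ q
    * ENNReal.ofReal (wt Θ ^ (2 * (q - 1)))

theorem prod_chartIdx (p : Fin (n + 1)) (p' : Fin (m + 1)) (F : Idx l n m → ENNReal) :
    ∏ i : ChartIdx l p p', F i = (∏ i, F (Sum.inl i))
      * ((∏ j, if j ≠ p then F (Sum.inr (Sum.inl j)) else 1)
        * ∏ j, if j ≠ p' then F (Sum.inr (Sum.inr j)) else 1) := by
  have h : ∏ i : ChartIdx l p p', F i = ∏ i : Idx l n m,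
      if i ≠ Sum.inr (Sum.inl p) ∧ i ≠ Sum.inr (Sum.inr p') then F i else 1 := by
    rw [← Finset.prod_filter]
    exact (Finset.prod_subtype _ (by simp) _).symm
  rw [h, Fintype.prod_sum_type, Fintype.prod_sum_type]
  simp

theorem norm_zPart_le (Z : Amb l n m) : ‖zPart Z‖ ≤ ‖Z‖ := by
  refine abs_le_of_sq_le_sq' ?_ (by positivity) |>.2
  rw [EuclideanSpace.norm_sq_eq, EuclideanSpace.norm_sq_eq, Fintype.sum_sum_type,
    Fintype.sum_sum_type]
  have h1 : 0 ≤ ∑ i, ‖Z (Sum.inl i)‖ ^ 2 := by positivity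
  have h2 : 0 ≤ ∑ i, ‖Z (Sum.inr (Sum.inr i))‖ ^ 2 := by positivity
  simp only [zPart]
  linarith

theorem norm_wPart_le (Z : Amb l n m) : ‖wPart Z‖ ≤ ‖Z‖ := by
  refine abs_le_of_sq_le_sq' ?_ (by positivity) |>.2
  rw [EuclideanSpace.norm_sq_eq, EuclideanSpace.norm_sq_eq, Fintype.sum_sum_type,
    Fintype.sum_sum_type]
  have h1 : 0 ≤ ∑ i, ‖Z (Sum.inl i)‖ ^ 2 := by positivity
  have h2 : 0 ≤ ∑ i, ‖Z (Sum.inr (Sum.inl i))‖ ^ 2 := by positivity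
  simp only [wPart]
  linarith

theorem radialWeight_le_prod (hn : 2 ≤ n) (hm : 2 ≤ m) {p : Fin (n + 1)} {p' : Fin (m + 1)}
    {b b' : Bool × Bool} {Θ : Amb l n m} (hΘ : Θ ∈ HNPiece l p p' b b') (hΘ1 : ‖Θ‖ ≤ 1)
    {q r : ℝ} (hq1 : 1 ≤ q) (hq2 : q < 2) (hr : 0 < r) (hr4 : r ≤ 4) :
    radialWeight q r Θ
      ≤ ENNReal.ofReal (16 * (n + 1) ^ 2 * (16 * (m + 1) ^ 2) * r ^ (-(4 * (q - 1))))
        * ∏ i, hWeight r (chart p p' Θ i) ^ q := by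
  have hz := coneWeight_le_prod hn hΘ.1 ((norm_zPart_le Θ).trans hΘ1) hq1 hq2 hr hr4
  have hw := coneWeight_le_prod hm hΘ.2 ((norm_wPart_le Θ).trans hΘ1) hq1 hq2 hr hr4
  have hwt : wt Θ ^ (2 * (q - 1)) = (‖zPart Θ‖ / ‖zPart Θ (Fin.last n)‖) ^ (2 * (q - 1))
      * (‖wPart Θ‖ / ‖wPart Θ (Fin.last m)‖) ^ (2 * (q - 1)) := by
    rw [wt, mul_div_mul_comm, Real.mul_rpow (by positivity) (by positivity)]
  have hc : ENNReal.ofReal (16 * (n + 1) ^ 2 * (16 * (m + 1) ^ 2) * r ^ (-(4 * (q - 1))))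
      = ENNReal.ofReal (16 * (n + 1) ^ 2 * r ^ (-(2 * (q - 1))))
        * ENNReal.ofReal (16 * (m + 1) ^ 2 * r ^ (-(2 * (q - 1)))) := by
    rw [← ENNReal.ofReal_mul (by positivity)]
    congr 1
    have : r ^ (-(4 * (q - 1))) = r ^ (-(2 * (q - 1))) * r ^ (-(2 * (q - 1))) := by
      rw [← Real.rpow_add hr]; congr 1; ring
    rw [this]; ring
  have hprod := prod_chartIdx p p' fun i => hWeight r (Θ i) ^ q
  have hone : 1 ≤ ∏ i : Fin l, hWeight r (Θ (Sum.inl i)) ^ q :=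
    Finset.one_le_prod' fun i _ => ENNReal.one_le_rpow (one_le_hWeight _ _) (by linarith)
  calc radialWeight q r Θ
      = (ENNReal.ofReal (1 + r / ‖zPart Θ‖) ^ q
          * ENNReal.ofReal ((‖zPart Θ‖ / ‖zPart Θ (Fin.last n)‖) ^ (2 * (q - 1))))
        * (ENNReal.ofReal (1 + r / ‖wPart Θ‖) ^ q
          * ENNReal.ofReal ((‖wPart Θ‖ / ‖wPart Θ (Fin.last m)‖) ^ (2 * (q - 1)))) := by
        rw [radialWeight, hwt, ENNReal.ofReal_mul (by positivity)]; ring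
    _ ≤ _ := mul_le_mul' hz hw
    _ = ENNReal.ofReal (16 * (n + 1) ^ 2 * (16 * (m + 1) ^ 2) * r ^ (-(4 * (q - 1))))
        * ((∏ j, if j ≠ p then hWeight r (zPart Θ j) ^ q else 1)
          * ∏ j, if j ≠ p' then hWeight r (wPart Θ j) ^ q else 1) := by rw [hc]; ring
    _ ≤ _ := by
        refine mul_le_mul_right ?_ _
        refine le_trans ?_ hprod.symm.le
        exact le_mul_of_one_le_left' hone

/-- Growth of the weighted volume of balls. -/
theorem exists_setLIntegral_radialWeight_le (hn : 2 ≤ n) (hm : 2 ≤ m) {q : ℝ} (hq1 : 1 ≤ q)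
    (hq2 : q < 2) :
    ∃ K : NNReal, ∀ (Z : Amb l n m) (r : ℝ), 0 < r → r ≤ 4 →
      ∫⁻ Θ in MN l n m ∩ Metric.ball Z r, radialWeight q r Θ ∂(dV l n m)
        ≤ K * ENNReal.ofReal (r ^ (2 * ((l + n + m : ℕ) : ℝ) - 4 * (q - 1))) := by
  obtain ⟨K₁, hK₁⟩ := exists_setLIntegral_hWeight_le (q := q) (by linarith) hq2
  have hpiece : ∀ t : (Fin (n + 1) × Fin (m + 1)) × (Bool × Bool) × (Bool × Bool),
      ∃ K : NNReal, ∀ (Z : Amb l n m) (r : ℝ), 0 < r → r ≤ 4 →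
        ∫⁻ Θ in HNPiece l t.1.1 t.1.2 t.2.1 t.2.2 ∩ (MN l n m ∩ Metric.ball Z r),
          radialWeight q r Θ ∂(dV l n m)
        ≤ K * ENNReal.ofReal (r ^ (2 * ((l + n + m : ℕ) : ℝ) - 4 * (q - 1))) := by
    rintro ⟨⟨p, p'⟩, b, b'⟩
    have hfr : Module.finrank ℝ (ChartIdx l p p' → ℂ) = 2 * (l + n + m) := by
      rw [Module.finrank_pi_fintype, Finset.sum_const, Finset.card_univ, card_chartIdx,
        Complex.finrank_real_complex, smul_eq_mul, mul_comm]
    obtain ⟨K₂, hK₂⟩ := exists_setLIntegral_comp_le (Y := Amb l n m) hfr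
      ((l + n + m + 2) * (2 * (n + m + 2)))
    refine ⟨Real.toNNReal (16 * (n + 1) ^ 2 * (16 * (m + 1) ^ 2)) * (K₂ * K₁ ^ (l + n + m)),
      fun Z r hr hr4 => ?_⟩
    set A := HNPiece l p p' b b' ∩ (MN l n m ∩ Metric.ball Z r) with hA
    -- A Euclidean ball projects into the polydisc of the same radius; cutting off each coordinate
    -- separately keeps the integrand a product.
    set G : ℂ → ℂ → ENNReal := fun z => (Metric.ball z r).indicator fun y => hWeight r y ^ q
      with hG
    have hGm : ∀ z, Measurable (G z) := fun z =>
      ((measurable_hWeight r).pow_const q).indicator measurableSet_ball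
    set f : (ChartIdx l p p' → ℂ) → ENNReal := fun y => ∏ i : ChartIdx l p p', G (Z i) (y i) with hf
    have hfm : Measurable f :=
      Finset.measurable_prod _ fun i _ => (hGm _).comp (measurable_pi_apply i)
    set c := 16 * ((n : ℝ) + 1) ^ 2 * (16 * (m + 1) ^ 2) with hc
    have hc0 : 0 ≤ c := by positivity
    calc ∫⁻ Θ in A, radialWeight q r Θ ∂(dV l n m)
        ≤ ∫⁻ Θ in A, radialWeight q r Θ ∂μHE[2 * (l + n + m)] :=
          lintegral_mono' (Measure.restrict_mono' Filter.EventuallyLE.rfl Measure.restrict_le_self)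
            le_rfl
      _ ≤ ∫⁻ Θ in A, ENNReal.ofReal (c * r ^ (-(4 * (q - 1)))) * f (chart p p' Θ)
            ∂μHE[2 * (l + n + m)] := by
          refine setLIntegral_mono ((hfm.comp (continuous_chart p p').measurable).const_mul _)
            fun Θ hΘ => ?_
          have h1 : ‖Θ‖ ≤ 1 := by
            have := hΘ.2.1.2
            rw [mem_ball_zero_iff] at this
            exact this.le
          refine (radialWeight_le_prod hn hm hΘ.1 h1 hq1 hq2 hr hr4).trans ?_
          refine mul_le_mul_right (Finset.prod_le_prod' fun i _ => ?_) _
          have hb : chart p p' Θ i ∈ Metric.ball (Z i) r :=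
            lt_of_le_of_lt (PiLp.dist_apply_le Θ Z i) hΘ.2.2
          rw [hG]
          simp only [Set.indicator_of_mem hb, le_refl]
      _ = ENNReal.ofReal (c * r ^ (-(4 * (q - 1))))
            * ∫⁻ Θ in A, f (chart p p' Θ) ∂μHE[2 * (l + n + m)] :=
          lintegral_const_mul _ (hfm.comp (continuous_chart p p').measurable)
      _ ≤ ENNReal.ofReal (c * r ^ (-(4 * (q - 1)))) * (K₂ * ∫⁻ y, f y) := by
          refine mul_le_mul_right (hK₂ A _ (continuous_chart p p') ?_ f hfm) _
          exact fun x hx y hy => dist_le_chart hx.1 hy.1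
      _ ≤ ENNReal.ofReal (c * r ^ (-(4 * (q - 1))))
            * (K₂ * (K₁ * ENNReal.ofReal (r ^ 2)) ^ (l + n + m)) := by
          refine mul_le_mul_right (mul_le_mul_right ?_ _) _
          rw [hf, volume_pi, lintegral_pi_prod_eq_prod volume (fun i : ChartIdx l p p' => G (Z i))
            fun i => hGm _, ← card_chartIdx (l := l) p p', ← Finset.card_univ]
          refine Finset.prod_le_pow_card _ _ _ fun i _ => ?_
          rw [hG]
          simp only
          rw [lintegral_indicator measurableSet_ball]
          exact hK₁ _ _ hr
      _ = _ := by
          rw [ENNReal.ofReal_mul hc0, mul_pow, ← ENNReal.ofReal_pow (by positivity)]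
          have : r ^ (2 * ((l + n + m : ℕ) : ℝ) - 4 * (q - 1))
              = r ^ (-(4 * (q - 1))) * (r ^ 2) ^ (l + n + m) := by
            rw [← pow_mul, ← Real.rpow_natCast, ← Real.rpow_add hr]
            congr 1; push_cast; ring
          rw [this, ENNReal.ofReal_mul (p := r ^ (-(4 * (q - 1)))) (by positivity)]
          push_cast
          rw [ENNReal.ofReal]
          ring
  choose K hK using hpiece
  refine ⟨∑ t, K t, fun Z r hr hr4 => ?_⟩
  have hcover : MN l n m ∩ Metric.ball Z r ⊆
      ⋃ t : (Fin (n + 1) × Fin (m + 1)) × (Bool × Bool) × (Bool × Bool),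
        HNPiece l t.1.1 t.1.2 t.2.1 t.2.2 ∩ (MN l n m ∩ Metric.ball Z r) := by
    intro Θ hΘ
    obtain ⟨hz0, hw0, hz, hw⟩ := hΘ.1.1
    obtain ⟨p, b, hp⟩ := exists_mem_conePiece hz0 hz
    obtain ⟨p', b', hp'⟩ := exists_mem_conePiece hw0 hw
    exact Set.mem_iUnion.2 ⟨((p, p'), (b, b')), ⟨hp, hp'⟩, hΘ⟩
  refine (lintegral_mono_set hcover).trans ((lintegral_iUnion_le _ _).trans ?_)
  rw [tsum_fintype]
  rw [ENNReal.ofNNReal_finsetSum, Finset.sum_mul]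
  exact Finset.sum_le_sum fun t _ => hK t Z r hr hr4

/-! ### Estimates for `fac` and `comp` on the isotropic cone. -/

section Block

variable {k : ℕ}

theorem norm_conjVec (a : EuclideanSpace ℂ (Fin k)) : ‖conjVec a‖ = ‖a‖ := by
  simp [EuclideanSpace.norm_eq, conjVec]

theorem norm_bdot_le (a b : EuclideanSpace ℂ (Fin k)) : ‖bdot a b‖ ≤ ‖a‖ * ‖b‖ := by
  have h : bdot a b = inner ℂ (conjVec a) b := by
    simp [bdot, conjVec, PiLp.inner_apply, mul_comm]
  rw [h, ← norm_conjVec a]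
  exact norm_inner_le_norm _ _

theorem bdot_sub_left (a a' b : EuclideanSpace ℂ (Fin k)) :
    bdot (a - a') b = bdot a b - bdot a' b := by
  simp [bdot, sub_mul]

theorem bdot_sub_right (a b b' : EuclideanSpace ℂ (Fin k)) :
    bdot a (b - b') = bdot a b - bdot a b' := by
  simp [bdot, mul_sub]

theorem norm_fac_le {ζ z : EuclideanSpace ℂ (Fin k)} {M : ℝ} (hM : ‖ζ - z‖ ≤ M) :
    ‖fac ζ z‖ ≤ ‖ζ‖ * (2 * ‖ζ‖ + M) := by
  have hz : ‖z‖ ≤ ‖ζ‖ + M := by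
    have := norm_sub_norm_le z ζ
    rw [norm_sub_rev] at this
    linarith
  have h := norm_bdot_le z (conjVec ζ)
  rw [norm_conjVec] at h
  have h2 : ‖(‖ζ‖ : ℂ) ^ 2‖ = ‖ζ‖ ^ 2 := by simp
  refine (norm_add_le _ _).trans ?_
  rw [h2]
  nlinarith [norm_nonneg ζ]

theorem norm_fac_sub_le (ζ z z' : EuclideanSpace ℂ (Fin k)) :
    ‖fac ζ z - fac ζ z'‖ ≤ ‖ζ‖ * ‖z - z'‖ := by
  have h : fac ζ z - fac ζ z' = bdot (z - z') (conjVec ζ) := by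
    rw [bdot_sub_left, fac, fac]; ring
  rw [h, mul_comm, ← norm_conjVec ζ]
  exact norm_bdot_le _ _

theorem comp_eq {ζ z : EuclideanSpace ℂ (Fin k)} (hz : bdot z z = 0) (j : Fin k) :
    comp ζ z j = (starRingEnd ℂ) (z j - ζ j) * fac ζ z
      - (z j + ζ j) * (starRingEnd ℂ) (bdot z ζ) := by
  rw [comp, fac, bdot_sub_right, hz, sub_zero, map_sub, add_comm (bdot z _)]

/-- Since ζ • ζ = 0, z may be replaced by z - ζ. This gives the smallness and the factor |ζ| that
half cancels |ζ|^(-2). -/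
theorem norm_bdot_le_of_isotropic {ζ z : EuclideanSpace ℂ (Fin k)} (hζ : bdot ζ ζ = 0) :
    ‖bdot z ζ‖ ≤ ‖ζ - z‖ * ‖ζ‖ := by
  have h : bdot z ζ = bdot (z - ζ) ζ := by rw [bdot_sub_left, hζ, sub_zero]
  rw [h, norm_sub_rev]
  exact norm_bdot_le _ _

theorem norm_apply_add_le {ζ z : EuclideanSpace ℂ (Fin k)} {M : ℝ} (hM : ‖ζ - z‖ ≤ M)
    (j : Fin k) : ‖z j + ζ j‖ ≤ 2 * ‖ζ‖ + M := by
  have h1 : z j + ζ j = 2 * ζ j - (ζ - z) j := by simp; ring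
  rw [h1]
  refine (norm_sub_le _ _).trans ?_
  rw [norm_mul, Complex.norm_ofNat]
  have h2 := PiLp.norm_apply_le ζ j
  have h3 := PiLp.norm_apply_le (ζ - z) j
  linarith

theorem norm_apply_sub_le (ζ z : EuclideanSpace ℂ (Fin k)) (j : Fin k) :
    ‖z j - ζ j‖ ≤ ‖ζ - z‖ := by
  rw [norm_sub_rev]; exact PiLp.norm_apply_le (ζ - z) j

theorem norm_comp_le {ζ z : EuclideanSpace ℂ (Fin k)} (hζ : bdot ζ ζ = 0) (hz : bdot z z = 0)
    {M : ℝ} (hM : ‖ζ - z‖ ≤ M) (j : Fin k) :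
    ‖comp ζ z j‖ ≤ 2 * M * (‖ζ‖ * (2 * ‖ζ‖ + M)) := by
  have hM0 : 0 ≤ M := (norm_nonneg _).trans hM
  have h1 : ‖(starRingEnd ℂ) (z j - ζ j) * fac ζ z‖ ≤ M * (‖ζ‖ * (2 * ‖ζ‖ + M)) := by
    rw [norm_mul, RCLike.norm_conj]
    gcongr
    · exact (norm_apply_sub_le ζ z j).trans hM
    · exact norm_fac_le hM
  have h2 : ‖(z j + ζ j) * (starRingEnd ℂ) (bdot z ζ)‖ ≤ (2 * ‖ζ‖ + M) * (M * ‖ζ‖) := by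
    rw [norm_mul, RCLike.norm_conj]
    gcongr
    · exact norm_apply_add_le hM j
    · exact (norm_bdot_le_of_isotropic hζ).trans (by gcongr)
  rw [comp_eq hz]
  refine (norm_sub_le _ _).trans ((add_le_add h1 h2).trans_eq ?_)
  ring

/-- The difference telescopes into four terms, each containing one difference in z - z' and one
factor |ζ|. -/
theorem norm_comp_sub_le {ζ z z' : EuclideanSpace ℂ (Fin k)} (hζ : bdot ζ ζ = 0)
    (hz : bdot z z = 0) (hz' : bdot z' z' = 0) {M : ℝ} (hM : ‖ζ - z‖ ≤ M) (hM' : ‖ζ - z'‖ ≤ M)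
    (j : Fin k) :
    ‖comp ζ z j - comp ζ z' j‖ ≤ 4 * ‖z - z'‖ * (‖ζ‖ * (‖ζ‖ + M)) := by
  have hM0 : 0 ≤ M := (norm_nonneg _).trans hM
  have hid : comp ζ z j - comp ζ z' j
      = (starRingEnd ℂ) (z j - z' j) * fac ζ z
        + (starRingEnd ℂ) (z' j - ζ j) * (fac ζ z - fac ζ z')
        - (z j - z' j) * (starRingEnd ℂ) (bdot z ζ)
        - (z' j + ζ j) * (starRingEnd ℂ) (bdot (z - z') ζ) := by
    rw [comp_eq hz, comp_eq hz', bdot_sub_left]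
    simp only [map_sub]
    ring
  have hd : ‖z j - z' j‖ ≤ ‖z - z'‖ := PiLp.norm_apply_le (z - z') j
  have h1 : ‖(starRingEnd ℂ) (z j - z' j) * fac ζ z‖ ≤ ‖z - z'‖ * (‖ζ‖ * (2 * ‖ζ‖ + M)) := by
    rw [norm_mul, RCLike.norm_conj]
    gcongr
    exact norm_fac_le hM
  have h2 : ‖(starRingEnd ℂ) (z' j - ζ j) * (fac ζ z - fac ζ z')‖
      ≤ M * (‖ζ‖ * ‖z - z'‖) := by
    rw [norm_mul, RCLike.norm_conj]
    gcongr
    · exact (norm_apply_sub_le ζ z' j).trans hM'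
    · exact norm_fac_sub_le _ _ _
  have h3 : ‖(z j - z' j) * (starRingEnd ℂ) (bdot z ζ)‖ ≤ ‖z - z'‖ * (M * ‖ζ‖) := by
    rw [norm_mul, RCLike.norm_conj]
    gcongr
    exact (norm_bdot_le_of_isotropic hζ).trans (by gcongr)
  have h4 : ‖(z' j + ζ j) * (starRingEnd ℂ) (bdot (z - z') ζ)‖
      ≤ (2 * ‖ζ‖ + M) * (‖z - z'‖ * ‖ζ‖) := by
    rw [norm_mul, RCLike.norm_conj]
    gcongr
    · exact norm_apply_add_le hM' j
    · exact norm_bdot_le _ _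
  rw [hid]
  refine (norm_sub_le _ _).trans ?_
  refine (add_le_add (norm_sub_le _ _) le_rfl).trans ?_
  refine (add_le_add (add_le_add (norm_add_le _ _) le_rfl) le_rfl).trans ?_
  refine (add_le_add (add_le_add (add_le_add h1 h2) h3) h4).trans_eq ?_
  ring

end Block

/-! ### Estimates for the coefficients B_k. -/

theorem zPart_sub (Z Z' : Amb l n m) : zPart (Z - Z') = zPart Z - zPart Z' := rfl

theorem wPart_sub (Z Z' : Amb l n m) : wPart (Z - Z') = wPart Z - wPart Z' := rfl

theorem norm_zPart_sub_le (Z Z' : Amb l n m) : ‖zPart Z - zPart Z'‖ ≤ ‖Z - Z'‖ := by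
  rw [← zPart_sub]; exact norm_zPart_le _

theorem norm_wPart_sub_le (Z Z' : Amb l n m) : ‖wPart Z - wPart Z'‖ ≤ ‖Z - Z'‖ := by
  rw [← wPart_sub]; exact norm_wPart_le _

theorem norm_xPart_apply_sub_le (Z Z' : Amb l n m) (k : Fin l) :
    ‖xPart Z k - xPart Z' k‖ ≤ ‖Z - Z'‖ :=
  PiLp.norm_apply_le (Z - Z') (Sum.inl k)

theorem norm_B_le (c : Idx l n m → ℂ) {Θ Z : Amb l n m} (hΘ : Θ ∈ HN l n m) (hZ : Z ∈ HN l n m)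
    {M : ℝ} (hM : ‖Θ - Z‖ ≤ M) (j : Idx l n m) :
    ‖B c Θ Z j‖ ≤ ‖c j‖ * (8 * M * (‖zPart Θ‖ * (‖zPart Θ‖ + M))
      * (‖wPart Θ‖ * (‖wPart Θ‖ + M))) := by
  have hM0 : 0 ≤ M := (norm_nonneg _).trans hM
  obtain ⟨-, -, hΘz, hΘw⟩ := hΘ
  obtain ⟨-, -, hZz, hZw⟩ := hZ
  have hMz := (norm_zPart_sub_le Θ Z).trans hM
  have hMw := (norm_wPart_sub_le Θ Z).trans hM
  have hfz := norm_fac_le hMz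
  have hfw := norm_fac_le hMw
  set s := ‖zPart Θ‖ with hs
  set t := ‖wPart Θ‖ with ht
  have hs0 : 0 ≤ s := norm_nonneg _
  have ht0 : 0 ≤ t := norm_nonneg _
  have hS : s * (2 * s + M) ≤ 2 * (s * (s + M)) := by nlinarith
  have hT : t * (2 * t + M) ≤ 2 * (t * (t + M)) := by nlinarith
  have hS0 : 0 ≤ s * (s + M) := by positivity
  have hT0 : 0 ≤ t * (t + M) := by positivity
  rcases j with j | j | j
  · simp only [B]
    rw [mul_assoc, mul_assoc, norm_mul, norm_mul, norm_mul, ← map_sub, RCLike.norm_conj]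
    refine mul_le_mul_of_nonneg_left ?_ (norm_nonneg (c _))
    calc ‖xPart Θ j - xPart Z j‖ * (‖fac (zPart Θ) (zPart Z)‖ * ‖fac (wPart Θ) (wPart Z)‖)
        ≤ M * ((2 * (s * (s + M))) * (2 * (t * (t + M)))) := by
          gcongr
          · exact (norm_xPart_apply_sub_le Θ Z j).trans hM
          · exact hfz.trans hS
          · exact hfw.trans hT
      _ = 4 * (M * (s * (s + M)) * (t * (t + M))) := by ring
      _ ≤ 8 * (M * (s * (s + M)) * (t * (t + M))) := by gcongr; norm_num
      _ = _ := by ring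
  · simp only [B]
    rw [mul_assoc, norm_mul, norm_mul]
    refine mul_le_mul_of_nonneg_left ?_ (norm_nonneg (c _))
    calc ‖comp (zPart Θ) (zPart Z) j‖ * ‖fac (wPart Θ) (wPart Z)‖
        ≤ (2 * M * (2 * (s * (s + M)))) * (2 * (t * (t + M))) := by
          gcongr
          · exact (norm_comp_le hΘz hZz hMz j).trans (by gcongr)
          · exact hfw.trans hT
      _ = _ := by ring
  · simp only [B]
    rw [mul_assoc, norm_mul, norm_mul]
    refine mul_le_mul_of_nonneg_left ?_ (norm_nonneg (c _))
    calc ‖comp (wPart Θ) (wPart Z) j‖ * ‖fac (zPart Θ) (zPart Z)‖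
        ≤ (2 * M * (2 * (t * (t + M)))) * (2 * (s * (s + M))) := by
          gcongr
          · exact (norm_comp_le hΘw hZw hMw j).trans (by gcongr)
          · exact hfz.trans hS
      _ = _ := by ring

theorem norm_B_sub_le (c : Idx l n m → ℂ) {Θ Z Z' : Amb l n m} (hΘ : Θ ∈ HN l n m)
    (hZ : Z ∈ HN l n m) (hZ' : Z' ∈ HN l n m) {M : ℝ} (hM : ‖Θ - Z‖ ≤ M) (hM' : ‖Θ - Z'‖ ≤ M)
    (j : Idx l n m) :
    ‖B c Θ Z j - B c Θ Z' j‖ ≤ ‖c j‖ * (12 * ‖Z - Z'‖ * (‖zPart Θ‖ * (‖zPart Θ‖ + M))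
      * (‖wPart Θ‖ * (‖wPart Θ‖ + M))) := by
  have hM0 : 0 ≤ M := (norm_nonneg _).trans hM
  obtain ⟨-, -, hΘz, hΘw⟩ := hΘ
  obtain ⟨-, -, hZz, hZw⟩ := hZ
  obtain ⟨-, -, hZz', hZw'⟩ := hZ'
  have hMz := (norm_zPart_sub_le Θ Z).trans hM
  have hMw := (norm_wPart_sub_le Θ Z).trans hM
  have hMz' := (norm_zPart_sub_le Θ Z').trans hM'
  have hMw' := (norm_wPart_sub_le Θ Z').trans hM'
  have hfz := norm_fac_le hMz
  have hfw := norm_fac_le hMw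
  have hfz' := norm_fac_le hMz'
  have hdz := norm_fac_sub_le (zPart Θ) (zPart Z) (zPart Z')
  have hdw := norm_fac_sub_le (wPart Θ) (wPart Z) (wPart Z')
  have hz := norm_zPart_sub_le Z Z'
  have hw := norm_wPart_sub_le Z Z'
  set δ := ‖Z - Z'‖ with hδ
  have hδ0 : 0 ≤ δ := norm_nonneg _
  set s := ‖zPart Θ‖ with hs
  set t := ‖wPart Θ‖ with ht
  have hs0 : 0 ≤ s := norm_nonneg _
  have ht0 : 0 ≤ t := norm_nonneg _
  have hS : s * (2 * s + M) ≤ 2 * (s * (s + M)) := by nlinarith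
  have hT : t * (2 * t + M) ≤ 2 * (t * (t + M)) := by nlinarith
  have hS' : M * s ≤ s * (s + M) := by nlinarith
  have hT' : M * t ≤ t * (t + M) := by nlinarith
  have hS0 : 0 ≤ s * (s + M) := by positivity
  have hT0 : 0 ≤ t * (t + M) := by positivity
  set S := s * (s + M)
  set T := t * (t + M)
  rcases j with j | j | j
  · simp only [B]
    have hid : c (Sum.inl j) * ((starRingEnd ℂ) (xPart Θ j) - (starRingEnd ℂ) (xPart Z j))
          * fac (zPart Θ) (zPart Z) * fac (wPart Θ) (wPart Z)
        - c (Sum.inl j) * ((starRingEnd ℂ) (xPart Θ j) - (starRingEnd ℂ) (xPart Z' j))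
          * fac (zPart Θ) (zPart Z') * fac (wPart Θ) (wPart Z')
        = c (Sum.inl j) * (-(starRingEnd ℂ) (xPart Z j - xPart Z' j)
            * (fac (zPart Θ) (zPart Z) * fac (wPart Θ) (wPart Z))
          + (starRingEnd ℂ) (xPart Θ j - xPart Z' j)
            * ((fac (zPart Θ) (zPart Z) - fac (zPart Θ) (zPart Z')) * fac (wPart Θ) (wPart Z))
          + (starRingEnd ℂ) (xPart Θ j - xPart Z' j)
            * (fac (zPart Θ) (zPart Z')
              * (fac (wPart Θ) (wPart Z) - fac (wPart Θ) (wPart Z')))) := by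
      simp only [map_sub]; ring
    rw [hid, norm_mul]
    gcongr
    have hxM := (norm_xPart_apply_sub_le Θ Z' j).trans hM'
    have hxd : ‖xPart Z j - xPart Z' j‖ ≤ δ := norm_xPart_apply_sub_le Z Z' j
    refine norm_add₃_le.trans ?_
    simp only [norm_mul, norm_neg, RCLike.norm_conj]
    calc _ ≤ δ * ((2 * S) * (2 * T)) + M * ((s * δ) * (2 * T)) + M * ((2 * S) * (t * δ)) := by
          gcongr
          · exact hfz.trans hS
          · exact hfw.trans hT
          · exact hdz.trans (by gcongr)
          · exact hfw.trans hT
          · exact hfz'.trans hS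
          · exact hdw.trans (by gcongr)
      _ = 4 * δ * S * T + 2 * δ * (M * s) * T + 2 * δ * S * (M * t) := by ring
      _ ≤ 4 * δ * S * T + 2 * δ * S * T + 2 * δ * S * T := by gcongr
      _ ≤ 12 * (δ * S * T) := by
          have : 0 ≤ δ * S * T := by positivity
          linarith
      _ = _ := by ring
  · simp only [B]
    have hid : c (Sum.inr (Sum.inl j)) * comp (zPart Θ) (zPart Z) j * fac (wPart Θ) (wPart Z)
        - c (Sum.inr (Sum.inl j)) * comp (zPart Θ) (zPart Z') j * fac (wPart Θ) (wPart Z')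
        = c (Sum.inr (Sum.inl j)) *
          ((comp (zPart Θ) (zPart Z) j - comp (zPart Θ) (zPart Z') j) * fac (wPart Θ) (wPart Z)
          + comp (zPart Θ) (zPart Z') j
            * (fac (wPart Θ) (wPart Z) - fac (wPart Θ) (wPart Z'))) := by ring
    rw [hid, norm_mul]
    gcongr
    refine (norm_add_le _ _).trans ?_
    simp only [norm_mul]
    calc _ ≤ (4 * δ * S) * (2 * T) + (2 * M * (2 * S)) * (t * δ) := by
          gcongr
          · exact (norm_comp_sub_le hΘz hZz hZz' hMz hMz' j).trans (by gcongr)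
          · exact hfw.trans hT
          · exact (norm_comp_le hΘz hZz' hMz' j).trans (by gcongr)
          · exact hdw.trans (by gcongr)
      _ = 8 * δ * S * T + 4 * δ * S * (M * t) := by ring
      _ ≤ 8 * δ * S * T + 4 * δ * S * T := by gcongr
      _ = _ := by ring
  · simp only [B]
    have hid : c (Sum.inr (Sum.inr j)) * comp (wPart Θ) (wPart Z) j * fac (zPart Θ) (zPart Z)
        - c (Sum.inr (Sum.inr j)) * comp (wPart Θ) (wPart Z') j * fac (zPart Θ) (zPart Z')
        = c (Sum.inr (Sum.inr j)) *
          ((comp (wPart Θ) (wPart Z) j - comp (wPart Θ) (wPart Z') j) * fac (zPart Θ) (zPart Z)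
          + comp (wPart Θ) (wPart Z') j
            * (fac (zPart Θ) (zPart Z) - fac (zPart Θ) (zPart Z'))) := by ring
    rw [hid, norm_mul]
    gcongr
    refine (norm_add_le _ _).trans ?_
    simp only [norm_mul]
    calc _ ≤ (4 * δ * T) * (2 * S) + (2 * M * (2 * T)) * (s * δ) := by
          gcongr
          · exact (norm_comp_sub_le hΘw hZw hZw' hMw hMw' j).trans (by gcongr)
          · exact hfz.trans hS
          · exact (norm_comp_le hΘw hZw' hMw' j).trans (by gcongr)
          · exact hdz.trans (by gcongr)
      _ = 8 * δ * S * T + 4 * δ * (M * s) * T := by ring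
      _ ≤ 8 * δ * S * T + 4 * δ * S * T := by gcongr
      _ = _ := by ring

/-! ### Pointwise bounds on dyadic shells. -/

/-- The size of the Martinelli–Bochner kernel at a single point. -/
def kernelSize (c : Idx l n m → ℂ) (Θ Z : Amb l n m) : ℝ :=
  1 / (‖zPart Θ‖ ^ 2 * ‖wPart Θ‖ ^ 2) *
    ∑ j : Idx l n m, ‖B c Θ Z j / ((‖Θ - Z‖ ^ (2 * (l + n + m)) : ℝ) : ℂ)‖

theorem kernelSize_nonneg (c : Idx l n m → ℂ) (Θ Z : Amb l n m) : 0 ≤ kernelSize c Θ Z := by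
  unfold kernelSize; positivity

theorem Δ_nonneg (c : Idx l n m → ℂ) (Θ Z Z' : Amb l n m) : 0 ≤ Δ c Θ Z Z' := by
  unfold Δ; positivity

theorem wt_nonneg (Θ : Amb l n m) : 0 ≤ wt Θ := by
  unfold wt; positivity

/-- The quotient is 0 by the convention for division by zero. This disposes of the point Θ = Z,
which no dyadic shell contains. -/
theorem kernelSize_self (h : l + n + m ≠ 0) (c : Idx l n m → ℂ) (Z : Amb l n m) :
    kernelSize c Z Z = 0 := by
  have h' : 2 * (l + n + m) ≠ 0 := by omega
  simp [kernelSize, zero_pow h']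

theorem Δ_self (c : Idx l n m → ℂ) (Θ Z : Amb l n m) : Δ c Θ Z Z = 0 := by
  simp [Δ]

theorem Δ_le_add (c : Idx l n m → ℂ) (Θ Z Z' : Amb l n m) :
    Δ c Θ Z Z' ≤ kernelSize c Θ Z + kernelSize c Θ Z' := by
  rw [Δ, kernelSize, kernelSize, ← mul_add, ← Finset.sum_add_distrib]
  gcongr
  exact norm_sub_le _ _

/-- The factor `(1 + r/|ζ|)(1 + r/|η|)`. -/
def radialFactor (r : ℝ) (Θ : Amb l n m) : ℝ := (1 + r / ‖zPart Θ‖) * (1 + r / ‖wPart Θ‖)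

theorem mul_add_eq_radialFactor {Θ : Amb l n m} (hΘ : Θ ∈ HN l n m) (r : ℝ) :
    ‖zPart Θ‖ * (‖zPart Θ‖ + r) * (‖wPart Θ‖ * (‖wPart Θ‖ + r))
      = ‖zPart Θ‖ ^ 2 * ‖wPart Θ‖ ^ 2 * radialFactor r Θ := by
  have hs : ‖zPart Θ‖ ≠ 0 := norm_ne_zero_iff.2 hΘ.1
  have ht : ‖wPart Θ‖ ≠ 0 := norm_ne_zero_iff.2 hΘ.2.1
  rw [radialFactor]
  field_simp

theorem one_div_mul_sum_le {Θ : Amb l n m} (hΘ : Θ ∈ HN l n m) (c : Idx l n m → ℂ)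
    {r A : ℝ} (F : Idx l n m → ℝ)
    (hF : ∀ j, F j ≤ ‖c j‖ * (A * (‖zPart Θ‖ * (‖zPart Θ‖ + r) * (‖wPart Θ‖ * (‖wPart Θ‖ + r))))) :
    1 / (‖zPart Θ‖ ^ 2 * ‖wPart Θ‖ ^ 2) * ∑ j, F j ≤ (∑ j, ‖c j‖) * A * radialFactor r Θ := by
  have hs : 0 < ‖zPart Θ‖ := norm_pos_iff.2 hΘ.1
  have ht : 0 < ‖wPart Θ‖ := norm_pos_iff.2 hΘ.2.1
  rw [one_div, inv_mul_le_iff₀ (by positivity)]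
  refine (Finset.sum_le_sum fun j _ => hF j).trans_eq ?_
  rw [← Finset.sum_mul, mul_add_eq_radialFactor hΘ]
  ring

theorem kernelSize_le (c : Idx l n m → ℂ) {Θ Z : Amb l n m} (hΘ : Θ ∈ HN l n m)
    (hZ : Z ∈ HN l n m) {ρ : ℝ} (hρ : 0 < ρ) (h1 : ρ / 2 ≤ ‖Θ - Z‖) (h2 : ‖Θ - Z‖ < ρ) :
    kernelSize c Θ Z ≤ (∑ j, ‖c j‖) * (8 * 2 ^ (2 * (l + n + m)) * (ρ / ρ ^ (2 * (l + n + m))))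
      * radialFactor ρ Θ := by
  refine one_div_mul_sum_le hΘ c _ fun j => ?_
  have hR : 0 < ‖Θ - Z‖ := by linarith
  rw [norm_div, Complex.norm_real, Real.norm_of_nonneg (by positivity),
    div_le_iff₀ (by positivity)]
  refine (norm_B_le c hΘ hZ h2.le j).trans ?_
  rw [mul_assoc ‖c j‖]
  refine mul_le_mul_of_nonneg_left ?_ (norm_nonneg (c j))
  have hpow : ρ ^ (2 * (l + n + m)) ≤ 2 ^ (2 * (l + n + m)) * ‖Θ - Z‖ ^ (2 * (l + n + m)) := by
    rw [← mul_pow]; exact pow_le_pow_left₀ hρ.le (by linarith) _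
  have h3 : 1 ≤ 2 ^ (2 * (l + n + m)) / ρ ^ (2 * (l + n + m)) * ‖Θ - Z‖ ^ (2 * (l + n + m)) := by
    rw [div_mul_eq_mul_div, one_le_div (by positivity)]; exact hpow
  have h4 : 0 ≤ 8 * ρ * (‖zPart Θ‖ * (‖zPart Θ‖ + ρ) * (‖wPart Θ‖ * (‖wPart Θ‖ + ρ))) := by
    positivity
  calc 8 * ρ * (‖zPart Θ‖ * (‖zPart Θ‖ + ρ)) * (‖wPart Θ‖ * (‖wPart Θ‖ + ρ))
      = 8 * ρ * (‖zPart Θ‖ * (‖zPart Θ‖ + ρ) * (‖wPart Θ‖ * (‖wPart Θ‖ + ρ))) * 1 := by ring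
    _ ≤ 8 * ρ * (‖zPart Θ‖ * (‖zPart Θ‖ + ρ) * (‖wPart Θ‖ * (‖wPart Θ‖ + ρ)))
        * (2 ^ (2 * (l + n + m)) / ρ ^ (2 * (l + n + m)) * ‖Θ - Z‖ ^ (2 * (l + n + m))) :=
        mul_le_mul_of_nonneg_left h3 h4
    _ = _ := by ring

/-- The difference of two inverse powers at comparable radii. -/
theorem abs_inv_pow_sub_inv_pow_le {R R' ρ δ : ℝ} (hρ : 0 < ρ) (hR : ρ / 2 ≤ R) (hR' : ρ / 4 ≤ R')
    (hR2 : R ≤ 2 * ρ) (hR2' : R' ≤ 2 * ρ) (hd : |R - R'| ≤ δ) (D : ℕ) :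
    |(R ^ D)⁻¹ - (R' ^ D)⁻¹| ≤ δ * (D * 16 ^ D) / (ρ ^ D * ρ) := by
  have hRpos : 0 < R := by linarith
  have hRpos' : 0 < R' := by linarith
  have hδ : 0 ≤ δ := (abs_nonneg _).trans hd
  rcases D with - | D
  · simp
  have hnum : |R' ^ (D + 1) - R ^ (D + 1)| ≤ δ * (D + 1 : ℕ) * (2 * ρ) ^ D := by
    refine (abs_pow_sub_pow_le R' R (D + 1)).trans ?_
    rw [abs_sub_comm, abs_of_pos hRpos, abs_of_pos hRpos']
    simp only [Nat.add_sub_cancel]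
    gcongr
    exact max_le hR2' hR2
  have hden : (ρ / 2 * (ρ / 4)) ^ (D + 1) ≤ R ^ (D + 1) * R' ^ (D + 1) := by
    rw [← mul_pow]; gcongr
  rw [inv_sub_inv (by positivity) (by positivity), abs_div,
    abs_of_pos (a := R ^ (D + 1) * R' ^ (D + 1)) (by positivity)]
  calc _ ≤ δ * (D + 1 : ℕ) * (2 * ρ) ^ D / (ρ / 2 * (ρ / 4)) ^ (D + 1) := by gcongr
    -- The constant is 2^D from the numerator times 8^(D+1) from the denominator (ρ²/8)^(D+1).
    _ = δ * ((D + 1 : ℕ) * (8 * 16 ^ D)) / (ρ ^ (D + 1) * ρ) := by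
        rw [div_eq_div_iff (by positivity) (by positivity)]
        have : (ρ / 2 * (ρ / 4)) ^ (D + 1) * 8 * 16 ^ D = ρ ^ (D + 1) * ρ ^ (D + 1) * 2 ^ D := by
          rw [show (16 : ℝ) = 8 * 2 by norm_num, mul_pow 8 2, ← mul_pow ρ,
            show ρ * ρ = (ρ / 2 * (ρ / 4)) * 8 by ring, mul_pow _ (8 : ℝ)]
          ring
        calc _ = δ * (D + 1 : ℕ) * (ρ ^ (D + 1) * ρ ^ (D + 1) * 2 ^ D) := by
              rw [mul_pow]; ring
          _ = _ := by rw [← this]; ring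
    _ ≤ _ := by
        gcongr
        rw [pow_succ, mul_comm]
        gcongr
        norm_num

/-- The condition |Θ - Z| ≥ 2|Z - Z'| makes both distances comparable to ρ. The difference of
quotients splits into a change of B_k and a change of the inverse power. Both radii are bounded by
2ρ, which doubles each of the two cone factors: 48 = 12·4 and 64 = 8·2·4. -/
theorem Δ_le (c : Idx l n m → ℂ) {Θ Z Z' : Amb l n m} (hΘ : Θ ∈ HN l n m)
    (hZ : Z ∈ HN l n m) (hZ' : Z' ∈ HN l n m) {ρ : ℝ} (hρ : 0 < ρ) (h1 : ρ / 2 ≤ ‖Θ - Z‖)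
    (h2 : ‖Θ - Z‖ < ρ) (hδ : 2 * ‖Z - Z'‖ ≤ ‖Θ - Z‖) :
    Δ c Θ Z Z' ≤ (∑ j, ‖c j‖)
      * ((48 * 2 ^ (2 * (l + n + m)) + 64 * ((2 * (l + n + m) : ℕ) * 16 ^ (2 * (l + n + m))))
        * (‖Z - Z'‖ / ρ ^ (2 * (l + n + m)))) * radialFactor ρ Θ := by
  refine one_div_mul_sum_le hΘ c _ fun j => ?_
  have habs : |‖Θ - Z‖ - ‖Θ - Z'‖| ≤ ‖Z - Z'‖ := by
    refine (abs_norm_sub_norm_le _ _).trans_eq ?_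
    rw [sub_sub_sub_cancel_left, norm_sub_rev]
  have habs' := abs_le.1 habs
  have hM : ‖Θ - Z‖ ≤ 2 * ρ := by linarith
  have hM' : ‖Θ - Z'‖ ≤ 2 * ρ := by linarith
  have hB := norm_B_sub_le c hΘ hZ hZ' hM hM' j
  have hB' := norm_B_le c hΘ hZ' hM' j
  have hinv := abs_inv_pow_sub_inv_pow_le hρ h1 (by linarith : ρ / 4 ≤ ‖Θ - Z'‖) hM hM' habs
    (2 * (l + n + m))
  have hpow : (‖Θ - Z‖ ^ (2 * (l + n + m)))⁻¹
      ≤ 2 ^ (2 * (l + n + m)) / ρ ^ (2 * (l + n + m)) := by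
    rw [← div_pow, ← inv_pow]
    refine pow_le_pow_left₀ (by positivity) ?_ _
    rw [inv_le_comm₀ (by linarith) (by positivity), inv_div]
    exact h1
  set D := 2 * (l + n + m) with hD
  set s := ‖zPart Θ‖ with hs
  set t := ‖wPart Θ‖ with ht
  set δ := ‖Z - Z'‖ with hδ'
  have hs0 : 0 ≤ s := norm_nonneg _
  have ht0 : 0 ≤ t := norm_nonneg _
  have hδ0 : 0 ≤ δ := norm_nonneg _
  have hS : s * (s + 2 * ρ) ≤ 2 * (s * (s + ρ)) := by nlinarith
  have hT : t * (t + 2 * ρ) ≤ 2 * (t * (t + ρ)) := by nlinarith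
  set S := s * (s + ρ) with hSdef
  set T := t * (t + ρ) with hTdef
  have hS0 : 0 ≤ S := by positivity
  have hT0 : 0 ≤ T := by positivity
  have hid : B c Θ Z j / ((‖Θ - Z‖ ^ D : ℝ) : ℂ) - B c Θ Z' j / ((‖Θ - Z'‖ ^ D : ℝ) : ℂ)
      = (B c Θ Z j - B c Θ Z' j) * (((‖Θ - Z‖ ^ D)⁻¹ : ℝ) : ℂ)
        + B c Θ Z' j * ((((‖Θ - Z‖ ^ D)⁻¹ - (‖Θ - Z'‖ ^ D)⁻¹ : ℝ)) : ℂ) := by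
    push_cast
    ring
  rw [hid]
  refine (norm_add_le _ _).trans ?_
  rw [norm_mul, norm_mul, Complex.norm_real, Complex.norm_real, Real.norm_eq_abs, Real.norm_eq_abs,
    abs_of_nonneg (a := (‖Θ - Z‖ ^ D)⁻¹) (by positivity)]
  calc _ ≤ (‖c j‖ * (12 * δ * (2 * S) * (2 * T))) * (2 ^ D / ρ ^ D)
        + (‖c j‖ * (8 * (2 * ρ) * (2 * S) * (2 * T))) * (δ * (D * 16 ^ D) / (ρ ^ D * ρ)) := by
        refine add_le_add (mul_le_mul (hB.trans ?_) hpow (by positivity) (by positivity))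
          (mul_le_mul (hB'.trans ?_) hinv (abs_nonneg _) (by positivity))
        · gcongr
        · gcongr
    _ = _ := by
        field_simp
        ring

theorem ofReal_mul_radialFactor_rpow {q A r : ℝ} (hq : 0 ≤ q) (hA : 0 ≤ A) (hr : 0 ≤ r)
    (Θ : Amb l n m) :
    ENNReal.ofReal ((A * radialFactor r Θ) ^ q * wt Θ ^ (2 * (q - 1)))
      = ENNReal.ofReal (A ^ q) * radialWeight q r Θ := by
  have h1 : 0 ≤ 1 + r / ‖zPart Θ‖ := by positivity
  have h2 : 0 ≤ 1 + r / ‖wPart Θ‖ := by positivity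
  rw [radialFactor, radialWeight, Real.mul_rpow hA (mul_nonneg h1 h2), Real.mul_rpow h1 h2,
    ENNReal.ofReal_mul (by positivity), ENNReal.ofReal_mul (by positivity),
    ENNReal.ofReal_mul (by positivity), ENNReal.ofReal_rpow_of_nonneg h1 hq,
    ENNReal.ofReal_rpow_of_nonneg h2 hq, mul_assoc]

/-! ### Continuity and measurability. -/

theorem continuous_zPart : Continuous (zPart : Amb l n m → _) := by
  unfold zPart; fun_prop

theorem continuous_wPart : Continuous (wPart : Amb l n m → _) := by
  unfold wPart; fun_prop

theorem continuous_xPart : Continuous (xPart : Amb l n m → _) := by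
  unfold xPart; fun_prop

theorem continuous_conjVec {k : ℕ} : Continuous (conjVec (k := k)) := by
  unfold conjVec; fun_prop

theorem continuous_bdot {k : ℕ} {X : Type*} [TopologicalSpace X]
    {f g : X → EuclideanSpace ℂ (Fin k)} (hf : Continuous f) (hg : Continuous g) :
    Continuous fun x => bdot (f x) (g x) := by
  unfold bdot; fun_prop

theorem continuous_fac {k : ℕ} {X : Type*} [TopologicalSpace X]
    {f g : X → EuclideanSpace ℂ (Fin k)} (hf : Continuous f) (hg : Continuous g) :
    Continuous fun x => fac (f x) (g x) := by
  have := continuous_bdot hg (continuous_conjVec.comp hf)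
  unfold fac; fun_prop

theorem continuous_comp_apply {k : ℕ} {X : Type*} [TopologicalSpace X]
    {f g : X → EuclideanSpace ℂ (Fin k)} (hf : Continuous f) (hg : Continuous g) (j : Fin k) :
    Continuous fun x => comp (f x) (g x) j := by
  have h1 := continuous_bdot hg (continuous_conjVec.comp hf)
  have h2 := continuous_bdot hg (hg.sub hf |>.neg)
  have h3 := continuous_bdot hg (hf.sub hg)
  have h4 := Complex.continuous_conj
  unfold comp; fun_prop

theorem continuous_B (c : Idx l n m → ℂ) (Z : Amb l n m) (j : Idx l n m) :
    Continuous fun Θ => B c Θ Z j := by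
  have h1 := continuous_fac (continuous_zPart (l := l) (n := n) (m := m))
    (continuous_const (y := zPart Z))
  have h2 := continuous_fac (continuous_wPart (l := l) (n := n) (m := m))
    (continuous_const (y := wPart Z))
  have h3 := Complex.continuous_conj
  rcases j with j | j | j <;> simp only [B]
  · have h4 := continuous_xPart (l := l) (n := n) (m := m)
    fun_prop
  · have h4 := continuous_comp_apply (continuous_zPart (l := l) (n := n) (m := m))
      (continuous_const (y := zPart Z)) j
    fun_prop
  · have h4 := continuous_comp_apply (continuous_wPart (l := l) (n := n) (m := m))
      (continuous_const (y := wPart Z)) j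
    fun_prop

theorem measurable_kernelSize (c : Idx l n m → ℂ) (Z : Amb l n m) :
    Measurable fun Θ => kernelSize c Θ Z := by
  have h1 := (continuous_zPart (l := l) (n := n) (m := m)).measurable
  have h2 := (continuous_wPart (l := l) (n := n) (m := m)).measurable
  have h3 := fun j => (continuous_B c Z j).measurable
  unfold kernelSize
  fun_prop

theorem measurable_wt : Measurable (wt : Amb l n m → ℝ) := by
  have h1 := (continuous_zPart (l := l) (n := n) (m := m)).measurable
  have h2 := (continuous_wPart (l := l) (n := n) (m := m)).measurable
  unfold wt
  fun_prop

theorem measurable_radialWeight (q r : ℝ) :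
    Measurable (radialWeight q r : Amb l n m → ENNReal) := by
  have h1 := (continuous_zPart (l := l) (n := n) (m := m)).measurable
  have h2 := (continuous_wPart (l := l) (n := n) (m := m)).measurable
  have h3 := measurable_wt (l := l) (n := n) (m := m)
  unfold radialWeight
  fun_prop

theorem measurableSet_MN : MeasurableSet (MN l n m) := by
  have hz := continuous_zPart (l := l) (n := n) (m := m)
  have hw := continuous_wPart (l := l) (n := n) (m := m)
  refine MeasurableSet.inter ?_ measurableSet_ball
  exact (isOpen_ne.preimage hz).measurableSet.inter
    ((isOpen_ne.preimage hw).measurableSet.inter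
      ((isClosed_singleton.preimage (continuous_bdot hz hz)).measurableSet.inter
        (isClosed_singleton.preimage (continuous_bdot hw hw)).measurableSet))

theorem norm_sub_lt_two {Θ Z : Amb l n m} (hΘ : Θ ∈ MN l n m) (hZ : Z ∈ MN l n m) :
    ‖Θ - Z‖ < 2 := by
  have h1 := mem_ball_zero_iff.1 hΘ.2
  have h2 := mem_ball_zero_iff.1 hZ.2
  linarith [norm_sub_le Θ Z]

theorem measurableSet_annulus (Z : Amb l n m) (a b : ℝ) :
    MeasurableSet {Θ : Amb l n m | a ≤ ‖Θ - Z‖ ∧ ‖Θ - Z‖ < b} := by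
  have h : Measurable fun Θ : Amb l n m => ‖Θ - Z‖ := by fun_prop
  exact h (measurableSet_Ico (a := a) (b := b))

/-! ### Integrals over the near and far regions. -/

/-- Integrals over dyadic shells, given the growth bound of the weighted volume. -/
theorem setLIntegral_shell_le {q : ℝ} {K : NNReal} {E : ℝ}
    (hK : ∀ (Z : Amb l n m) (r : ℝ), 0 < r → r ≤ 4 →
      ∫⁻ Θ in MN l n m ∩ Metric.ball Z r, radialWeight q r Θ ∂(dV l n m)
        ≤ K * ENNReal.ofReal (r ^ E))
    {Z : Amb l n m} (hZ : Z ∈ MN l n m) {ρ : ℝ} (hρ : 0 < ρ) (Φ : Amb l n m → ENNReal)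
    (A : ENNReal) (hΦ : ∀ Θ ∈ MN l n m, ρ / 2 ≤ ‖Θ - Z‖ → ‖Θ - Z‖ < ρ →
      Φ Θ ≤ A * radialWeight q ρ Θ) :
    ∫⁻ Θ in {Θ | ρ / 2 ≤ ‖Θ - Z‖ ∧ ‖Θ - Z‖ < ρ}, Φ Θ ∂((dV l n m).restrict (MN l n m))
      ≤ A * (K * ENNReal.ofReal (ρ ^ E)) := by
  rw [Measure.restrict_restrict (measurableSet_annulus Z _ _)]
  rcases le_or_gt ρ 4 with h4 | h4
  · calc _ ≤ ∫⁻ Θ in {Θ | ρ / 2 ≤ ‖Θ - Z‖ ∧ ‖Θ - Z‖ < ρ} ∩ MN l n m, A * radialWeight q ρ Θ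
          ∂(dV l n m) :=
          setLIntegral_mono ((measurable_radialWeight q ρ).const_mul A)
            fun Θ hΘ => hΦ Θ hΘ.2 hΘ.1.1 hΘ.1.2
      _ ≤ ∫⁻ Θ in MN l n m ∩ Metric.ball Z ρ, A * radialWeight q ρ Θ ∂(dV l n m) :=
          lintegral_mono_set fun Θ hΘ => ⟨hΘ.2, by
            rw [Metric.mem_ball, dist_eq_norm]; exact hΘ.1.2⟩
      _ = A * ∫⁻ Θ in MN l n m ∩ Metric.ball Z ρ, radialWeight q ρ Θ ∂(dV l n m) :=
          lintegral_const_mul _ (measurable_radialWeight q ρ)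
      _ ≤ _ := mul_le_mul_right (hK Z ρ hρ h4) _
  -- For ρ > 4 the inner radius exceeds 2, the diameter of the unit ball.
  · have hempty : {Θ | ρ / 2 ≤ ‖Θ - Z‖ ∧ ‖Θ - Z‖ < ρ} ∩ MN l n m = ∅ := by
      ext Θ
      simp only [Set.mem_inter_iff, Set.mem_empty_iff_false, iff_false]
      rintro ⟨⟨h1, -⟩, h2⟩
      linarith [norm_sub_lt_two h2 hZ]
    rw [hempty]
    simp

theorem div_pow_rpow {ρ q : ℝ} (hρ : 0 < ρ) (a : ℝ) (ha : 0 ≤ a) (D : ℕ) :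
    (a / ρ ^ D) ^ q = a ^ q * ρ ^ (-(D * q)) := by
  rw [Real.div_rpow ha (by positivity), ← Real.rpow_natCast, ← Real.rpow_mul hρ.le,
    Real.rpow_neg hρ.le, div_eq_mul_inv]

/-- The integral of a single kernel over a small ball. -/
theorem exists_setLIntegral_kernelSize_le (hn : 2 ≤ n) (hm : 2 ≤ m) (c : Idx l n m → ℂ) {q : ℝ}
    (hq1 : 1 ≤ q) (hq2 : q < 2)
    (hE : 0 < 2 * ((l + n + m : ℕ) : ℝ) + 4 - (2 * ((l + n + m : ℕ) : ℝ) + 3) * q) :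
    ∃ K : NNReal, ∀ Z ∈ MN l n m, ∀ r, 0 < r →
      ∫⁻ Θ in {Θ | ‖Θ - Z‖ < r}, ENNReal.ofReal (kernelSize c Θ Z ^ q * wt Θ ^ (2 * (q - 1)))
        ∂((dV l n m).restrict (MN l n m))
      ≤ K * ENNReal.ofReal
        (r ^ (2 * ((l + n + m : ℕ) : ℝ) + 4 - (2 * ((l + n + m : ℕ) : ℝ) + 3) * q)) := by
  obtain ⟨K, hK⟩ := exists_setLIntegral_radialWeight_le (l := l) hn hm hq1 hq2
  set E := 2 * ((l + n + m : ℕ) : ℝ) + 4 - (2 * ((l + n + m : ℕ) : ℝ) + 3) * q with hEdef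
  have hq0 : 0 ≤ q := by linarith
  set S := ∑ j, ‖c j‖ with hS
  have hS0 : 0 ≤ S := by positivity
  set a := S * (8 * 2 ^ (2 * (l + n + m))) with ha
  have ha0 : 0 ≤ a := by positivity
  set b := (1 - (1 / 2 : ℝ) ^ E)⁻¹ with hb
  refine ⟨Real.toNNReal (a ^ q) * K * Real.toNNReal b, fun Z hZ r hr => ?_⟩
  set Φ := fun Θ : Amb l n m =>
    ENNReal.ofReal (kernelSize c Θ Z ^ q * wt Θ ^ (2 * (q - 1))) with hΦ
  have hcover : {Θ : Amb l n m | ‖Θ - Z‖ < r} ⊆ {Θ | 0 < ‖Θ - Z‖ ∧ ‖Θ - Z‖ < r} ∪ {Z} := by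
    intro Θ h
    by_cases h0 : Θ = Z
    · exact Or.inr h0
    · exact Or.inl ⟨norm_pos_iff.2 (sub_ne_zero.2 h0), h⟩
  have hZ0 : ∫⁻ Θ in {Z}, Φ Θ ∂((dV l n m).restrict (MN l n m)) = 0 := by
    have : Φ Z = 0 := by
      simp only [hΦ]
      rw [kernelSize_self (by omega), Real.zero_rpow (by linarith), zero_mul, ENNReal.ofReal_zero]
    rw [lintegral_singleton, this, zero_mul]
  have hmain := setLIntegral_lt_le_of_shell ((dV l n m).restrict (MN l n m))
    (fun Θ => ‖Θ - Z‖) Φ hr hE (ENNReal.ofReal (a ^ q) * K) fun ρ hρ _ => by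
      refine (setLIntegral_shell_le hK hZ hρ Φ
        (ENNReal.ofReal ((a * (ρ / ρ ^ (2 * (l + n + m)))) ^ q)) ?_).trans_eq ?_
      · intro Θ hΘ h1 h2
        rw [← ofReal_mul_radialFactor_rpow hq0 (by positivity) hρ.le]
        refine ENNReal.ofReal_le_ofReal ?_
        have := wt_nonneg Θ
        refine mul_le_mul_of_nonneg_right ?_ (by positivity)
        refine Real.rpow_le_rpow (kernelSize_nonneg _ _ _) ?_ hq0
        refine (kernelSize_le c hΘ.1 hZ.1 hρ h1 h2).trans_eq ?_
        rw [ha, hS]; ring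
      · rw [Real.mul_rpow ha0 (by positivity), div_pow_rpow hρ _ hρ.le,
          ENNReal.ofReal_mul (by positivity)]
        -- The kernel contributes ρ^((1-2N)q) and the weighted volume ρ^(2N-4(q-1)).
        have : ρ ^ E = ρ ^ q * ρ ^ (-(((2 * (l + n + m) : ℕ) : ℝ) * q))
            * ρ ^ (2 * ((l + n + m : ℕ) : ℝ) - 4 * (q - 1)) := by
          rw [← Real.rpow_add hρ, ← Real.rpow_add hρ, hEdef]
          congr 1; push_cast; ring
        rw [this, ENNReal.ofReal_mul (p := ρ ^ q * _) (by positivity)]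
        ring
  calc _ ≤ _ := lintegral_mono_set hcover
    _ ≤ _ := lintegral_union_le _ _ _
    _ ≤ ENNReal.ofReal (a ^ q) * K * ENNReal.ofReal (r ^ E * b) + 0 := add_le_add hmain hZ0.le
    _ = _ := by
        rw [ENNReal.ofReal_mul (by positivity), add_zero]
        push_cast
        simp only [ENNReal.ofReal]
        ring

/-- The contribution of the region `|Θ - Z| < 2|Z - Z'|`. -/
theorem exists_setLIntegral_near_le (hn : 2 ≤ n) (hm : 2 ≤ m) (c : Idx l n m → ℂ) {q : ℝ}
    (hq1 : 1 ≤ q) (hq2 : q < 2)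
    (hE : 0 < 2 * ((l + n + m : ℕ) : ℝ) + 4 - (2 * ((l + n + m : ℕ) : ℝ) + 3) * q) :
    ∃ K : NNReal, ∀ Z ∈ MN l n m, ∀ Z' ∈ MN l n m, 0 < ‖Z - Z'‖ →
      ∫⁻ Θ in {Θ | ‖Θ - Z‖ < 2 * ‖Z - Z'‖},
        ENNReal.ofReal (Δ c Θ Z Z' ^ q * wt Θ ^ (2 * (q - 1)))
        ∂((dV l n m).restrict (MN l n m))
      ≤ K * ENNReal.ofReal (‖Z - Z'‖
        ^ (2 * ((l + n + m : ℕ) : ℝ) + 4 - (2 * ((l + n + m : ℕ) : ℝ) + 3) * q)) := by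
  obtain ⟨K, hK⟩ := exists_setLIntegral_kernelSize_le (l := l) hn hm c hq1 hq2 hE
  set E := 2 * ((l + n + m : ℕ) : ℝ) + 4 - (2 * ((l + n + m : ℕ) : ℝ) + 3) * q with hEdef
  have hq0 : 0 ≤ q := by linarith
  refine ⟨Real.toNNReal (2 ^ q) * (K * Real.toNNReal (2 ^ E) + K * Real.toNNReal (3 ^ E)),
    fun Z hZ Z' hZ' hδ => ?_⟩
  set δ := ‖Z - Z'‖ with hδ'
  set μ := (dV l n m).restrict (MN l n m) with hμ
  set Φ := fun (Y Θ : Amb l n m) =>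
    ENNReal.ofReal (kernelSize c Θ Y ^ q * wt Θ ^ (2 * (q - 1))) with hΦ
  have hΦm : ∀ Y, Measurable (Φ Y) := fun Y => by
    have h1 := measurable_kernelSize c Y
    have h2 := measurable_wt (l := l) (n := n) (m := m)
    simp only [hΦ]
    fun_prop
  have hpt : ∀ Θ, ENNReal.ofReal (Δ c Θ Z Z' ^ q * wt Θ ^ (2 * (q - 1)))
      ≤ ENNReal.ofReal (2 ^ q) * (Φ Z Θ + Φ Z' Θ) := by
    intro Θ
    have hw : 0 ≤ wt Θ ^ (2 * (q - 1)) := Real.rpow_nonneg (wt_nonneg Θ) _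
    have hk := Real.rpow_nonneg (kernelSize_nonneg c Θ Z) q
    have hk' := Real.rpow_nonneg (kernelSize_nonneg c Θ Z') q
    simp only [hΦ]
    rw [← ENNReal.ofReal_add (mul_nonneg hk hw) (mul_nonneg hk' hw),
      ← ENNReal.ofReal_mul (by positivity), ← add_mul, ← mul_assoc]
    refine ENNReal.ofReal_le_ofReal (mul_le_mul_of_nonneg_right ?_ hw)
    -- Bounding the sum by twice the maximum gives (a+b)^q ≤ 2^q (a^q + b^q).
    have hmax : Δ c Θ Z Z' ≤ 2 * max (kernelSize c Θ Z) (kernelSize c Θ Z') := by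
      refine (Δ_le_add c Θ Z Z').trans ?_
      rw [two_mul]
      exact add_le_add (le_max_left _ _) (le_max_right _ _)
    refine (Real.rpow_le_rpow (Δ_nonneg _ _ _ _) hmax hq0).trans ?_
    rw [Real.mul_rpow (by norm_num) (le_max_of_le_left (kernelSize_nonneg c Θ Z))]
    refine mul_le_mul_of_nonneg_left ?_ (by positivity)
    rcases max_choice (kernelSize c Θ Z) (kernelSize c Θ Z') with h | h <;> rw [h] <;> linarith
  calc _ ≤ ∫⁻ Θ in {Θ | ‖Θ - Z‖ < 2 * δ}, ENNReal.ofReal (2 ^ q) * (Φ Z Θ + Φ Z' Θ) ∂μ :=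
        lintegral_mono hpt
    _ = ENNReal.ofReal (2 ^ q) * (∫⁻ Θ in {Θ | ‖Θ - Z‖ < 2 * δ}, Φ Z Θ ∂μ
          + ∫⁻ Θ in {Θ | ‖Θ - Z‖ < 2 * δ}, Φ Z' Θ ∂μ) := by
        rw [lintegral_const_mul _ (by have := hΦm Z; have := hΦm Z'; fun_prop),
          lintegral_add_left (hΦm Z)]
    _ ≤ ENNReal.ofReal (2 ^ q) * (∫⁻ Θ in {Θ | ‖Θ - Z‖ < 2 * δ}, Φ Z Θ ∂μ
          + ∫⁻ Θ in {Θ | ‖Θ - Z'‖ < 3 * δ}, Φ Z' Θ ∂μ) := by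
        refine mul_le_mul_right (add_le_add le_rfl (lintegral_mono_set fun Θ hΘ => ?_)) _
        have h : Θ - Z' = (Θ - Z) + (Z - Z') := by abel
        have hΘ' : ‖Θ - Z‖ < 2 * δ := hΘ
        change ‖Θ - Z'‖ < 3 * δ
        rw [h]
        linarith [norm_add_le (Θ - Z) (Z - Z')]
    _ ≤ ENNReal.ofReal (2 ^ q) * (K * ENNReal.ofReal ((2 * δ) ^ E)
          + K * ENNReal.ofReal ((3 * δ) ^ E)) :=
        mul_le_mul_right (add_le_add (hK Z hZ _ (by positivity)) (hK Z' hZ' _ (by positivity))) _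
    _ = _ := by
        rw [Real.mul_rpow (by norm_num) hδ.le, Real.mul_rpow (by norm_num) hδ.le,
          ENNReal.ofReal_mul (by positivity), ENNReal.ofReal_mul (by positivity)]
        push_cast
        simp only [ENNReal.ofReal]
        ring

/-- Dyadic shells in the region `|Θ - Z| ≥ 2|Z - Z'|`. -/
theorem exists_setLIntegral_far_shell_le (hn : 2 ≤ n) (hm : 2 ≤ m) (c : Idx l n m → ℂ) {q : ℝ}
    (hq1 : 1 ≤ q) (hq2 : q < 2) :
    ∃ K : NNReal, ∀ Z ∈ MN l n m, ∀ Z' ∈ MN l n m, ∀ ρ, 0 < ρ →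
      ∫⁻ Θ in {Θ | ρ / 2 ≤ ‖Θ - Z‖ ∧ ‖Θ - Z‖ < ρ},
        {Θ | 2 * ‖Z - Z'‖ ≤ ‖Θ - Z‖}.indicator
          (fun Θ => ENNReal.ofReal (Δ c Θ Z Z' ^ q * wt Θ ^ (2 * (q - 1)))) Θ
        ∂((dV l n m).restrict (MN l n m))
      ≤ K * ENNReal.ofReal (‖Z - Z'‖ ^ q)
        * ENNReal.ofReal (ρ ^ ((2 * ((l + n + m : ℕ) : ℝ) + 4) * (1 - q))) := by
  obtain ⟨K, hK⟩ := exists_setLIntegral_radialWeight_le (l := l) hn hm hq1 hq2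
  have hq0 : 0 ≤ q := by linarith
  set a := (∑ j, ‖c j‖) * (48 * 2 ^ (2 * (l + n + m))
    + 64 * ((2 * (l + n + m) : ℕ) * 16 ^ (2 * (l + n + m)))) with ha
  have ha0 : 0 ≤ a := by positivity
  refine ⟨Real.toNNReal (a ^ q) * K, fun Z hZ Z' hZ' ρ hρ => ?_⟩
  refine (setLIntegral_shell_le hK hZ hρ _
    (ENNReal.ofReal ((a * (‖Z - Z'‖ / ρ ^ (2 * (l + n + m)))) ^ q)) ?_).trans_eq ?_
  · intro Θ hΘ h1 h2
    by_cases hfar : 2 * ‖Z - Z'‖ ≤ ‖Θ - Z‖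
    · rw [Set.indicator_of_mem (by exact hfar),
        ← ofReal_mul_radialFactor_rpow hq0 (by positivity) hρ.le]
      refine ENNReal.ofReal_le_ofReal ?_
      have := wt_nonneg Θ
      refine mul_le_mul_of_nonneg_right ?_ (by positivity)
      refine Real.rpow_le_rpow (Δ_nonneg _ _ _ _) ?_ hq0
      refine (Δ_le c hΘ.1 hZ.1 hZ'.1 hρ h1 h2 hfar).trans_eq ?_
      rw [ha]; ring
    · rw [Set.indicator_of_notMem (by exact hfar)]
      exact zero_le
  · rw [Real.mul_rpow ha0 (by positivity), div_pow_rpow hρ _ (norm_nonneg _),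
      ENNReal.ofReal_mul (by positivity), ENNReal.ofReal_mul (by positivity)]
    have : ρ ^ ((2 * ((l + n + m : ℕ) : ℝ) + 4) * (1 - q))
        = ρ ^ (-(((2 * (l + n + m) : ℕ) : ℝ) * q))
          * ρ ^ (2 * ((l + n + m : ℕ) : ℝ) - 4 * (q - 1)) := by
      rw [← Real.rpow_add hρ]
      congr 1; push_cast; ring
    rw [this, ENNReal.ofReal_mul (p := ρ ^ (-(((2 * (l + n + m) : ℕ) : ℝ) * q))) (by positivity)]
    push_cast
    simp only [ENNReal.ofReal]
    ring

/-- The shell estimate is needed for every ρ > 2|Z - Z'|, including shells that reach inside the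
near region; the indicator removes that part without changing the integral over the far region. -/
theorem setLIntegral_indicator_far (μ : Measure (Amb l n m)) (Z : Amb l n m) (r : ℝ)
    (T : Set (Amb l n m)) (hT : MeasurableSet T) (hTr : ∀ Θ ∈ T, r ≤ ‖Θ - Z‖)
    (Φ : Amb l n m → ENNReal) :
    ∫⁻ Θ in T, Φ Θ ∂μ = ∫⁻ Θ in T, {Θ | r ≤ ‖Θ - Z‖}.indicator Φ Θ ∂μ :=
  setLIntegral_congr_fun hT fun Θ hΘ => (Set.indicator_of_mem
    (show Θ ∈ {Θ | r ≤ ‖Θ - Z‖} from hTr Θ hΘ) Φ).symm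

/-- The contribution of the region `|Θ - Z| ≥ 2|Z - Z'|` for `q > 1`. -/
theorem exists_setLIntegral_far_le (hn : 2 ≤ n) (hm : 2 ≤ m) (c : Idx l n m → ℂ) {q : ℝ}
    (hq1 : 1 < q) (hq2 : q < 2) :
    ∃ K : NNReal, ∀ Z ∈ MN l n m, ∀ Z' ∈ MN l n m, 0 < ‖Z - Z'‖ →
      ∫⁻ Θ in {Θ | 2 * ‖Z - Z'‖ ≤ ‖Θ - Z‖},
        ENNReal.ofReal (Δ c Θ Z Z' ^ q * wt Θ ^ (2 * (q - 1)))
        ∂((dV l n m).restrict (MN l n m))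
      ≤ K * ENNReal.ofReal (‖Z - Z'‖
        ^ (2 * ((l + n + m : ℕ) : ℝ) + 4 - (2 * ((l + n + m : ℕ) : ℝ) + 3) * q)) := by
  obtain ⟨K, hK⟩ := exists_setLIntegral_far_shell_le (l := l) hn hm c hq1.le hq2
  set e := (2 * ((l + n + m : ℕ) : ℝ) + 4) * (1 - q) with he
  have he0 : e < 0 := mul_neg_of_pos_of_neg (by positivity) (by linarith)
  refine ⟨K * Real.toNNReal (2 ^ e * (1 - 2 ^ e)⁻¹), fun Z hZ Z' hZ' hδ => ?_⟩
  rw [setLIntegral_indicator_far _ Z _ _ (measurableSet_le measurable_const (by fun_prop))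
    fun Θ hΘ => hΘ]
  refine (setLIntegral_ge_le_of_shell _ (fun Θ => ‖Θ - Z‖) _ (r := 2 * ‖Z - Z'‖) (by positivity)
    he0 _ fun ρ hρ => hK Z hZ Z' hZ' ρ (lt_trans (by positivity) hρ)).trans_eq ?_
  have h1 : ‖Z - Z'‖ ^ (2 * ((l + n + m : ℕ) : ℝ) + 4 - (2 * ((l + n + m : ℕ) : ℝ) + 3) * q)
      = ‖Z - Z'‖ ^ q * ‖Z - Z'‖ ^ e := by
    rw [← Real.rpow_add hδ, he]; congr 1; ring
  rw [h1, Real.mul_rpow (by norm_num) hδ.le, mul_comm ((2 : ℝ) ^ e), mul_assoc (_ ^ e),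
    ENNReal.ofReal_mul (p := ‖Z - Z'‖ ^ e) (by positivity),
    ENNReal.ofReal_mul (p := ‖Z - Z'‖ ^ q) (by positivity)]
  push_cast
  simp only [ENNReal.ofReal]
  ring

/-- The contribution of the region `|Θ - Z| ≥ 2|Z - Z'|` for `q = 1`. -/
theorem exists_setLIntegral_far_le_log (hn : 2 ≤ n) (hm : 2 ≤ m) (c : Idx l n m → ℂ) :
    ∃ K : NNReal, ∀ Z ∈ MN l n m, ∀ Z' ∈ MN l n m, 0 < ‖Z - Z'‖ →
      ∫⁻ Θ in {Θ | 2 * ‖Z - Z'‖ ≤ ‖Θ - Z‖ ∧ ‖Θ - Z‖ < 2},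
        ENNReal.ofReal (Δ c Θ Z Z' ^ (1 : ℝ) * wt Θ ^ (2 * ((1 : ℝ) - 1)))
        ∂((dV l n m).restrict (MN l n m))
      ≤ K * ENNReal.ofReal (‖Z - Z'‖ * (1 + |Real.log ‖Z - Z'‖|)) := by
  obtain ⟨K, hK⟩ := exists_setLIntegral_far_shell_le (l := l) hn hm c le_rfl one_lt_two
  refine ⟨K * 2, fun Z hZ Z' hZ' hδ => ?_⟩
  rw [setLIntegral_indicator_far _ Z (2 * ‖Z - Z'‖) _
    (measurableSet_annulus Z _ _) fun Θ hΘ => hΘ.1]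
  set δ := ‖Z - Z'‖ with hδ'
  -- This many doublings take the radius from 2δ to at least 2, so M shells exhaust the far region.
  set M := ⌈|Real.log δ| / Real.log 2⌉₊ with hM
  have hlog2 : 0 < Real.log 2 := Real.log_pos one_lt_two
  have hM1 : |Real.log δ| ≤ M * Real.log 2 := by
    rw [← div_le_iff₀ hlog2]; exact Nat.le_ceil _
  have hM2 : (M : ℝ) ≤ 2 * (1 + |Real.log δ|) := by
    have h1 : (M : ℝ) ≤ |Real.log δ| / Real.log 2 + 1 :=
      (Nat.ceil_lt_add_one (by positivity)).le
    have h2 : |Real.log δ| / Real.log 2 ≤ 2 * |Real.log δ| := by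
      rw [div_le_iff₀ hlog2]
      have := Real.log_two_gt_d9
      nlinarith [abs_nonneg (Real.log δ)]
    linarith
  have hT : 2 ≤ 2 * δ * 2 ^ M := by
    have h1 : Real.log 1 ≤ Real.log (δ * 2 ^ M) := by
      rw [Real.log_one, Real.log_mul hδ.ne' (by positivity), Real.log_pow]
      linarith [neg_abs_le (Real.log δ)]
    have h2 := (Real.log_le_log_iff one_pos (by positivity)).1 h1
    linarith
  refine (setLIntegral_ge_lt_le_of_shell _ (fun Θ => ‖Θ - Z‖) _ (r := 2 * δ) (by positivity)
    (K * ENNReal.ofReal δ) M hT fun ρ hρ => ?_).trans ?_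
  · refine (hK Z hZ Z' hZ' ρ (lt_trans (by positivity) hρ)).trans_eq ?_
    simp [hδ']
  · calc (M : ENNReal) * (K * ENNReal.ofReal δ)
        ≤ ENNReal.ofReal (2 * (1 + |Real.log δ|)) * (K * ENNReal.ofReal δ) := by
          refine mul_le_mul_left ?_ _
          rw [← ENNReal.ofReal_natCast]
          exact ENNReal.ofReal_le_ofReal hM2
      _ = _ := by
          rw [ENNReal.ofReal_mul (by norm_num), ENNReal.ofReal_mul hδ.le, ENNReal.ofReal_ofNat]
          push_cast
          ring

theorem setLIntegral_MN_le_add {Z : Amb l n m} (hZ : Z ∈ MN l n m) (Φ : Amb l n m → ENNReal)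
    (r : ℝ) :
    ∫⁻ Θ in MN l n m, Φ Θ ∂(dV l n m)
      ≤ ∫⁻ Θ in {Θ | ‖Θ - Z‖ < r}, Φ Θ ∂((dV l n m).restrict (MN l n m))
        + ∫⁻ Θ in {Θ | r ≤ ‖Θ - Z‖ ∧ ‖Θ - Z‖ < 2}, Φ Θ ∂((dV l n m).restrict (MN l n m)) := by
  refine le_trans ?_ (lintegral_union_le _ _ _)
  rw [Measure.restrict_restrict']
  · refine lintegral_mono_set fun Θ hΘ => ⟨?_, hΘ⟩
    rcases lt_or_ge ‖Θ - Z‖ r with h | h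
    · exact Or.inl h
    · exact Or.inr ⟨h, norm_sub_lt_two hΘ hZ⟩
  · exact measurableSet_MN

end MartinelliBochner

end

/-! ### Assembly of the near and far estimates. -/

theorem theorem7p2 (l n m : ℕ) (hl : 1 ≤ l) (hn : 2 ≤ n) (hm : 2 ≤ m)
    (c : MartinelliBochner.Idx l n m → ℂ) (q : ℝ) (hq1 : 1 ≤ q)
    (hq : q < (2 * ((l + n + m : ℕ) : ℝ) + 4) / (2 * ((l + n + m : ℕ) : ℝ) + 3)) :
    ∃ C : ℝ, 0 < C ∧
      ∀ Z ∈ MartinelliBochner.MN l n m, ∀ Z' ∈ MartinelliBochner.MN l n m,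
        (1 < q →
          ∫⁻ Θ in MartinelliBochner.MN l n m,
              ENNReal.ofReal (MartinelliBochner.Δ c Θ Z Z' ^ q
                * MartinelliBochner.wt Θ ^ (2 * (q - 1))) ∂(MartinelliBochner.dV l n m)
            ≤ ENNReal.ofReal (C * ‖Z - Z'‖ ^ (2 * ((l + n + m : ℕ) : ℝ) + 4
                - (2 * ((l + n + m : ℕ) : ℝ) + 3) * q))) ∧
        (q = 1 →
          ∫⁻ Θ in MartinelliBochner.MN l n m,
              ENNReal.ofReal (MartinelliBochner.Δ c Θ Z Z' ^ q
                * MartinelliBochner.wt Θ ^ (2 * (q - 1))) ∂(MartinelliBochner.dV l n m)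
            ≤ ENNReal.ofReal (C * (‖Z - Z'‖ * (1 + |Real.log ‖Z - Z'‖|)))) := by
  have hN : (0 : ℝ) ≤ ((l + n + m : ℕ) : ℝ) := Nat.cast_nonneg _
  rw [lt_div_iff₀ (by positivity)] at hq
  have hE : 0 < 2 * ((l + n + m : ℕ) : ℝ) + 4 - (2 * ((l + n + m : ℕ) : ℝ) + 3) * q := by linarith
  have hq2 : q < 2 := by nlinarith
  obtain ⟨K₁, hK₁⟩ := MartinelliBochner.exists_setLIntegral_near_le hn hm c hq1 hq2 hE
  obtain ⟨K₂, hK₂⟩ : ∃ K : NNReal, 1 < q →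
      ∀ Z ∈ MartinelliBochner.MN l n m, ∀ Z' ∈ MartinelliBochner.MN l n m, 0 < ‖Z - Z'‖ →
      ∫⁻ Θ in {Θ | 2 * ‖Z - Z'‖ ≤ ‖Θ - Z‖},
        ENNReal.ofReal (MartinelliBochner.Δ c Θ Z Z' ^ q
          * MartinelliBochner.wt Θ ^ (2 * (q - 1)))
        ∂((MartinelliBochner.dV l n m).restrict (MartinelliBochner.MN l n m))
      ≤ K * ENNReal.ofReal (‖Z - Z'‖
        ^ (2 * ((l + n + m : ℕ) : ℝ) + 4 - (2 * ((l + n + m : ℕ) : ℝ) + 3) * q)) := by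
    by_cases h : 1 < q
    · obtain ⟨K, hK⟩ := MartinelliBochner.exists_setLIntegral_far_le hn hm c h hq2
      exact ⟨K, fun _ => hK⟩
    · exact ⟨0, fun h' => absurd h' h⟩
  obtain ⟨K₃, hK₃⟩ := MartinelliBochner.exists_setLIntegral_far_le_log (l := l) hn hm c
  refine ⟨K₁ + K₂ + K₃ + 1, by positivity, fun Z hZ Z' hZ' => ?_⟩
  have hdiag : Z = Z' → ∫⁻ Θ in MartinelliBochner.MN l n m,
      ENNReal.ofReal (MartinelliBochner.Δ c Θ Z Z' ^ q
        * MartinelliBochner.wt Θ ^ (2 * (q - 1))) ∂(MartinelliBochner.dV l n m) = 0 := by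
    rintro rfl
    simp [MartinelliBochner.Δ_self, Real.zero_rpow (by linarith : q ≠ 0)]
  have hcoe : ∀ K : NNReal, (K : ENNReal) = ENNReal.ofReal K := fun K =>
    (ENNReal.ofReal_coe_nnreal).symm
  refine ⟨fun h1 => ?_, fun h1 => ?_⟩
  · by_cases hZZ : Z = Z'
    · rw [hdiag hZZ]; exact zero_le
    have hδ : 0 < ‖Z - Z'‖ := norm_pos_iff.2 (sub_ne_zero.2 hZZ)
    refine (MartinelliBochner.setLIntegral_MN_le_add hZ _ (2 * ‖Z - Z'‖)).trans ?_
    refine (add_le_add (hK₁ Z hZ Z' hZ' hδ)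
      ((lintegral_mono_set fun Θ hΘ => hΘ.1).trans (hK₂ h1 Z hZ Z' hZ' hδ))).trans ?_
    rw [← add_mul, ENNReal.ofReal_mul (by positivity), hcoe, hcoe,
      ← ENNReal.ofReal_add (by positivity) (by positivity)]
    refine mul_le_mul_left (ENNReal.ofReal_le_ofReal ?_) _
    linarith [K₃.coe_nonneg]
  · subst h1
    by_cases hZZ : Z = Z'
    · rw [hdiag hZZ]; exact zero_le
    have hδ : 0 < ‖Z - Z'‖ := norm_pos_iff.2 (sub_ne_zero.2 hZZ)
    refine (MartinelliBochner.setLIntegral_MN_le_add hZ _ (2 * ‖Z - Z'‖)).trans ?_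
    refine (add_le_add (hK₁ Z hZ Z' hZ' hδ) (hK₃ Z hZ Z' hZ' hδ)).trans ?_
    -- At q = 1 the near exponent is 1, so the near region is absorbed by the logarithmic bound.
    have hpow : ‖Z - Z'‖ ^ (2 * ((l + n + m : ℕ) : ℝ) + 4 - (2 * ((l + n + m : ℕ) : ℝ) + 3) * 1)
        ≤ ‖Z - Z'‖ * (1 + |Real.log ‖Z - Z'‖|) := by
      rw [show 2 * ((l + n + m : ℕ) : ℝ) + 4 - (2 * ((l + n + m : ℕ) : ℝ) + 3) * 1 = 1 by ring,
        Real.rpow_one]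
      exact le_mul_of_one_le_right hδ.le (by linarith [abs_nonneg (Real.log ‖Z - Z'‖)])
    refine (add_le_add (mul_le_mul_right (ENNReal.ofReal_le_ofReal hpow) _) le_rfl).trans ?_
    rw [← add_mul, ENNReal.ofReal_mul (p := (K₁ : ℝ) + K₂ + K₃ + 1) (by positivity), hcoe, hcoe,
      ← ENNReal.ofReal_add (by positivity) (by positivity)]
    refine mul_le_mul_left (ENNReal.ofReal_le_ofReal ?_) _
    linarith [K₂.coe_nonneg]
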